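/- Consider the balanced sub-Gaussian mixture model with $n\ge 4$ points in $\mathbb{R}^d$ and $k\ge 2$ clusters. There are fixed centers $\mu_1,\dots,\mu_k\in\mathbb{R}^d$ and fixed labels $\sigma^*:[n]\to[k]$ with $|\{i:\sigma^*(i)=a\}|=n/k$ for every $a\in[k]$. The observed points are $h_i=\mu_{\sigma^*(i)}+g_i$, $i\in[n]$, where $g_1,\dots,g_n$ are independent, mean-zero random vectors in $\mathbb{R}^d$ with sub-Gaussian norms $\|g_i\|_{\psi_2}\le\tau$, $\tau>0$. Here $\|X\|_{\psi_2}=\inf\{t>0:\mathbb{E}\exp(X^2/t^2)\le 2\}$ for a real random variable $X$, and $\|x\|_{\psi_2}=\sup_{\|u\|_2=1}\|\langle x,u\rangle\|_{\psi_2}$ for a random vector $x$. Let $\Delta=\min_{a\ne b}\|\mu_a-\mu_b\|_2$ and $s=\Delta/\tau$, and write $\|M\|_1=\sum_{i,j}|M_{ij}|$. Let $A\in\mathbb{R}^{n\times n}$ with $A_{ij}=\|h_i-h_j\|_2^2$, and let $\hat Y$ be an optimal solution of the semidefinite program $$\min_{Y\in\mathbb{R}^{n\times n}}\ \operatorname{Tr}(Y^\top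 A)\quad\text{s.t.}\quad Y\mathbf{1}_n=\tfrac nk\mathbf{1}_n,\quad Y\succeq 0,\quad \operatorname{diag}(Y)=\mathbf{1}_n,\quad Y\ge 0\ \text{entrywise}.$$ Let $Y^*\in\{0,1\}^{n\times n}$ be the true cluster matrix: $Y^*_{ij}=1$ if $\sigma^*(i)=\sigma^*(j)$, and $Y^*_{ij}=0$ otherwise. Let $\mathcal{F}=\{F\in\{0,1\}^{n\times k}:F\mathbf{1}_k=\mathbf{1}_n\}$ be the set of assignment matrices, and let $F^*\in\mathcal{F}$ be the true one: $F^*_{ja}=1$ if $\sigma^*(j)=a$, and $F^*_{ja}=0$ otherwise. Let $\bar h_j=\mu_{\sigma^*(j)}+4g_j$, with the same $g_j$ as above, and for $F\in\mathcal{F}$ let $$\eta(F)=\sum_{j=1}^n\sum_{a=1}^k\|\bar h_j-\mu_a\|_2^2\,F_{ja},$$ which is the objective of the Oracle Integer Program $\min_{F\in\mathcal{F}}\eta(F)$. **Theorem (IP bounds SDP).** There are universal constants $C_s>0$ and $C\ge 1$ such that, in the model above, if $$s^2\ \ge\ C_s\left(\sqrt{\frac{kd}{n}\log n}+\frac{kd}{n}+k\right),$$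 then with probability at least $1-n^{-C}-2e^{-n}$ every optimal solution $\hat Y$ of the semidefinite program satisfies $$\frac{\|\hat Y-Y^*\|_1}{\|Y^*\|_1}\ \le\ 2\max\left\{\frac{\|F-F^*\|_1}{\|F^*\|_1}:\ F\in\mathcal{F},\ \eta(F)\le\eta(F^*)\right\}.$$ -/

import Mathlib

open MeasureTheory ProbabilityTheory
open scoped ENNReal NNReal

noncomputable section

namespace HiddenIntegrality

/-- The sub-Gaussian norm `inf {t > 0 : E exp (X² / t²) ≤ 2}` of a real random variable, as an
extended nonnegative number (so that it is `∞` when there is no such `t`). -/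
def psi2Norm {Ω : Type*} [MeasurableSpace Ω] (P : Measure Ω) (X : Ω → ℝ) : ℝ≥0∞ :=
  ⨅ (t : ℝ≥0) (_ : 0 < t) (_ : ∫⁻ ω, ENNReal.ofReal (Real.exp (X ω ^ 2 / (t : ℝ) ^ 2)) ∂P ≤ 2),
    (t : ℝ≥0∞)

/-- The sub-Gaussian norm of a random vector: the supremum of the sub-Gaussian norms of its
one-dimensional marginals along unit vectors. -/
def psi2NormVec {Ω : Type*} [MeasurableSpace Ω] (P : Measure Ω) {d : ℕ}
    (x : Ω → EuclideanSpace ℝ (Fin d)) : ℝ≥0∞ :=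
  ⨆ u ∈ Metric.sphere (0 : EuclideanSpace ℝ (Fin d)) 1, psi2Norm P (fun ω => inner ℝ (x ω) u)

/-- The random part of the balanced sub-Gaussian mixture model: labels `σ` with clusters of equal
size `n / k`, and noise vectors `g i` that are independent, centered and sub-Gaussian with
sub-Gaussian norm at most `τ`. -/
structure IsBalancedSGMM {Ω : Type*} [MeasurableSpace Ω] (P : Measure Ω) {n k d : ℕ} (τ : ℝ)
    (σ : Fin n → Fin k) (g : Fin n → Ω → EuclideanSpace ℝ (Fin d)) : Prop where
  measurable : ∀ i, Measurable (g i)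
  indep : iIndepFun g P
  mean_zero : ∀ i, ∫ ω, g i ω ∂P = 0
  subGaussian : ∀ i, psi2NormVec P (g i) ≤ ENNReal.ofReal τ
  balanced : ∀ a, ((Finset.univ.filter fun i => σ i = a).card : ℝ) = (n : ℝ) / (k : ℝ)

/-- The minimum separation of the centers; for `k ≥ 2` the infimum is over a finite nonempty set
of pairs. -/
def minSep {k d : ℕ} (c : Fin k → EuclideanSpace ℝ (Fin d)) : ℝ :=
  ⨅ p : {p : Fin k × Fin k // p.1 ≠ p.2}, ‖c p.1.1 - c p.1.2‖

/-- Entrywise `ℓ₁` norm of a matrix. -/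
def l1 {m n : Type*} [Fintype m] [Fintype n] (M : Matrix m n ℝ) : ℝ := ∑ i, ∑ j, |M i j|

/-- The observed points `c (σ i) + g i`, for a realization `g` of the noise. -/
def dataPoint {n k d : ℕ} (c : Fin k → EuclideanSpace ℝ (Fin d)) (σ : Fin n → Fin k)
    (g : Fin n → EuclideanSpace ℝ (Fin d)) (i : Fin n) : EuclideanSpace ℝ (Fin d) :=
  c (σ i) + g i

/-- The points of the oracle problem: the same noise, scaled by `4`. -/
def oraclePoint {n k d : ℕ} (c : Fin k → EuclideanSpace ℝ (Fin d)) (σ : Fin n → Fin k)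
    (g : Fin n → EuclideanSpace ℝ (Fin d)) (i : Fin n) : EuclideanSpace ℝ (Fin d) :=
  c (σ i) + (4 : ℝ) • g i

/-- The matrix of pairwise squared distances. -/
def distMatrix {n d : ℕ} (h : Fin n → EuclideanSpace ℝ (Fin d)) : Matrix (Fin n) (Fin n) ℝ :=
  Matrix.of fun i j => ‖h i - h j‖ ^ 2

/-- The trace inner product. -/
def frob {n : ℕ} (M Q : Matrix (Fin n) (Fin n) ℝ) : ℝ := (M.transpose * Q).trace

/-- The feasible set of the semidefinite program. -/
def sdpFeasible (n k : ℕ) : Set (Matrix (Fin n) (Fin n) ℝ) :=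
  {Y | (∀ i, ∑ j, Y i j = (n : ℝ) / (k : ℝ)) ∧ Y.PosSemidef ∧ (∀ i, Y i i = 1) ∧
    ∀ i j, 0 ≤ Y i j}

/-- `Y` is an optimal solution of the semidefinite program with input matrix `A`. -/
def IsSDPSolution {n : ℕ} (k : ℕ) (A Y : Matrix (Fin n) (Fin n) ℝ) : Prop :=
  Y ∈ sdpFeasible n k ∧ ∀ Z ∈ sdpFeasible n k, frob Y A ≤ frob Z A

/-- The true cluster matrix. -/
def clusterMatrix {n k : ℕ} (σ : Fin n → Fin k) : Matrix (Fin n) (Fin n) ℝ :=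
  Matrix.of fun i j => if σ i = σ j then 1 else 0

/-- The set of assignment matrices: 0-1 matrices all of whose rows sum to one. -/
def assignments (n k : ℕ) : Set (Matrix (Fin n) (Fin k) ℝ) :=
  {F | (∀ i a, F i a = 0 ∨ F i a = 1) ∧ ∀ i, ∑ a, F i a = 1}

/-- The true assignment matrix. -/
def trueAssignment {n k : ℕ} (σ : Fin n → Fin k) : Matrix (Fin n) (Fin k) ℝ :=
  Matrix.of fun j a => if σ j = a then 1 else 0

/-- The objective of the Oracle Integer Program with centers `c` and points `h`. -/
def eta {n k d : ℕ} (c : Fin k → EuclideanSpace ℝ (Fin d))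
    (h : Fin n → EuclideanSpace ℝ (Fin d)) (F : Matrix (Fin n) (Fin k) ℝ) : ℝ :=
  ∑ j, ∑ a, ‖h j - c a‖ ^ 2 * F j a

/-- The normalized errors of the assignment matrices whose oracle objective is at most that of the
true assignment. -/
def oracleErrors {n k d : ℕ} (c : Fin k → EuclideanSpace ℝ (Fin d)) (σ : Fin n → Fin k)
    (g : Fin n → EuclideanSpace ℝ (Fin d)) : Set ℝ :=
  {r | ∃ F ∈ assignments n k,
    eta c (oraclePoint c σ g) F ≤ eta c (oraclePoint c σ g) (trueAssignment σ) ∧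
    r = l1 (F - trueAssignment σ) / l1 (trueAssignment σ)}

/-- The worst-case normalized error of the Oracle Integer Program. -/
def oracleError {n k d : ℕ} (c : Fin k → EuclideanSpace ℝ (Fin d)) (σ : Fin n → Fin k)
    (g : Fin n → EuclideanSpace ℝ (Fin d)) : ℝ :=
  sSup (oracleErrors c σ g)

theorem trueAssignment_mem {n k : ℕ} (σ : Fin n → Fin k) :
    trueAssignment σ ∈ assignments n k := by
  refine ⟨fun i a => ?_, fun i => ?_⟩
  · by_cases h : σ i = a <;> simp [trueAssignment, h]
  · simp [trueAssignment]

theorem finite_assignments (n k : ℕ) : (assignments n k).Finite := by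
  have h : (Set.pi Set.univ fun _ : Fin n => Set.pi Set.univ fun _ : Fin k =>
      ({0, 1} : Set ℝ)).Finite :=
    Set.Finite.pi fun _ => Set.Finite.pi fun _ => Set.toFinite _
  exact h.subset fun F hF i _ a _ => by simpa using hF.1 i a

/-- The supremum that defines `oracleError` is a maximum. -/
theorem isGreatest_oracleError {n k d : ℕ} (c : Fin k → EuclideanSpace ℝ (Fin d))
    (σ : Fin n → Fin k) (g : Fin n → EuclideanSpace ℝ (Fin d)) :
    IsGreatest (oracleErrors c σ g) (oracleError c σ g) := by
  have hfin : (oracleErrors c σ g).Finite := by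
    refine ((finite_assignments n k).image fun F =>
      l1 (F - trueAssignment σ) / l1 (trueAssignment σ)).subset ?_
    rintro r ⟨F, hF, -, rfl⟩
    exact ⟨F, hF, rfl⟩
  have hne : (oracleErrors c σ g).Nonempty :=
    ⟨_, trueAssignment σ, trueAssignment_mem σ, le_rfl, rfl⟩
  exact ⟨hne.csSup_mem hfin, fun _ hr => le_csSup hfin.bddAbove hr⟩

end HiddenIntegrality

end

/-!
All rows of a feasible matrix sum to `n / k`, so optimality of `Ŷ` against `Y*` reads
`∑ Ŷᵢⱼ (‖c (σ i) - c (σ j)‖² + 4 ⟪gᵢ, c (σ i) - c (σ j)⟫) ≤ 2 ∑ (Ŷ - Y*)ᵢⱼ ⟪gᵢ, gⱼ⟫`.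
Subtracting from each `gᵢ` the mean of its cluster splits the right-hand side. The terms that
involve a mean are at most `‖Ŷ - Y*‖₁` times a bound on `⟪gᵢ, mean⟫`, and the centered part is at
most the squared operator norm of the noise times a trace proportional to `‖Ŷ - Y*‖₁`. Under the
separation condition sub-Gaussian concentration makes both at most half of the separation part of
the left-hand side. Hence `∑ Ŷᵢⱼ (‖c (σ i) - c (σ j)‖² + 8 ⟪gᵢ, c (σ i) - c (σ j)⟫) ≤ 0`: summing
each row of `Ŷ` over the clusters and dividing by `n / k` gives a fractional assignment whose
oracle cost, with noise `4 gᵢ`, is at most that of the truth. Rounding it to an integral one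
with the same property loses at most a factor 2 in the misassigned mass.
-/

noncomputable section

namespace HiddenIntegrality

open Finset
open scoped Topology

section Rounding

variable {ι κ : Type*} [Fintype ι]

theorem exists_finset_card_eq_threshold (δ : ι → ℝ) {w : ℕ} (hw : w ≤ Fintype.card ι) :
    ∃ S : Finset ι, #S = w ∧ ∃ t, (∀ i ∈ S, δ i ≤ t) ∧ ∀ j ∉ S, t ≤ δ j := by
  classical
  induction w with
  | zero =>
    obtain ⟨t, ht⟩ := (Set.finite_range δ).bddBelow
    exact ⟨∅, card_empty, t, by simp, fun j _ => ht (Set.mem_range_self j)⟩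
  | succ w ih =>
    obtain ⟨S, hcard, t, hS, hSc⟩ := ih (by lia)
    have hne : Sᶜ.Nonempty := by rw [← card_pos, card_compl]; lia
    obtain ⟨j, hj, hmin⟩ := exists_min_image Sᶜ δ hne
    have hj' : j ∉ S := mem_compl.1 hj
    refine ⟨insert j S, by rw [card_insert_of_notMem hj', hcard], δ j, fun i hi => ?_,
      fun i hi => hmin i (mem_compl.2 fun h => hi (mem_insert_of_mem h))⟩
    rcases mem_insert.1 hi with rfl | hi
    · exact le_rfl
    · exact (hS i hi).trans (hSc j hj')

theorem exists_finset_card_eq_sum_le {b : ι → ℝ} (hb0 : ∀ j, 0 ≤ b j) (hb1 : ∀ j, b j ≤ 1)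
    (δ : ι → ℝ) {w : ℕ} (hw : ∑ j, b j = w) :
    ∃ S : Finset ι, #S = w ∧ ∑ j ∈ S, δ j ≤ ∑ j, b j * δ j := by
  classical
  have hwn : w ≤ Fintype.card ι := by
    have h := sum_le_sum fun j (_ : j ∈ univ) => hb1 j
    rw [hw] at h
    simpa using h
  obtain ⟨S, hcard, t, hS, hSc⟩ := exists_finset_card_eq_threshold δ hwn
  refine ⟨S, hcard, ?_⟩
  have hshift : ∑ j ∈ S, (δ j - t) ≤ ∑ j, b j * (δ j - t) := by
    rw [← sum_ite_mem_eq S]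
    refine sum_le_sum fun j _ => ?_
    split_ifs with hj
    · nlinarith [hS j hj, hb1 j]
    · exact mul_nonneg (hb0 j) (sub_nonneg.2 (hSc j hj))
  simp only [mul_sub, sum_sub_distrib, ← sum_mul, hw, sum_const, hcard, nsmul_eq_mul] at hshift
  linarith

theorem exists_finset_sum_nonpos {b δ : ι → ℝ} (hb0 : ∀ j, 0 ≤ b j) (hb1 : ∀ j, b j ≤ 1)
    (hcost : ∑ j, b j * δ j ≤ 0) :
    ∃ S : Finset ι, ∑ j ∈ S, δ j ≤ 0 ∧ ∑ j, b j ≤ 2 * #S := by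
  set W := ∑ j, b j with hW
  rcases lt_or_ge W 1 with hlt | hge
  · by_cases hδ : ∃ j, δ j ≤ 0
    · obtain ⟨j, hj⟩ := hδ
      refine ⟨{j}, by simpa using hj, ?_⟩
      rw [card_singleton, Nat.cast_one]
      linarith
    · push Not at hδ
      have hbδ : ∀ j ∈ univ, b j * δ j = 0 :=
        (sum_eq_zero_iff_of_nonneg fun j _ => mul_nonneg (hb0 j) (hδ j).le).1
          (hcost.antisymm (sum_nonneg fun j _ => mul_nonneg (hb0 j) (hδ j).le))
      have hb : ∀ j ∈ univ, b j = 0 := fun j hj =>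
        (mul_eq_zero.1 (hbδ j hj)).resolve_right (hδ j).ne'
      exact ⟨∅, by simp, by simp [hW, sum_eq_zero hb]⟩
  · have hWpos : 0 < W := one_pos.trans_le hge
    have hr0 : 0 ≤ (⌊W⌋₊ : ℝ) / W := by positivity
    have hr1 : (⌊W⌋₊ : ℝ) / W ≤ 1 := (div_le_one hWpos).2 (Nat.floor_le hWpos.le)
    obtain ⟨S, hcard, hS⟩ := exists_finset_card_eq_sum_le (b := fun j => ⌊W⌋₊ / W * b j)
      (fun j => mul_nonneg hr0 (hb0 j)) (fun j => mul_le_one₀ hr1 (hb0 j) (hb1 j)) δ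
      (w := ⌊W⌋₊) (by rw [← mul_sum, ← hW]; field_simp)
    refine ⟨S, hS.trans ?_, ?_⟩
    · simp only [mul_assoc, ← mul_sum]
      exact mul_nonpos_of_nonneg_of_nonpos hr0 hcost
    · have hfloor : (1 : ℝ) ≤ ⌊W⌋₊ := by exact_mod_cast (Nat.one_le_floor_iff W).2 hge
      rw [hcard]
      linarith [Nat.lt_floor_add_one W]

theorem exists_labeling_sum_nonpos [Fintype κ] [Nontrivial κ] [DecidableEq κ] {σ : ι → κ}
    {B δ : ι → κ → ℝ} (hB0 : ∀ j a, 0 ≤ B j a) (hB1 : ∀ j, ∑ a, B j a = 1)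
    (hδ : ∀ j, δ j (σ j) = 0) (hcost : ∑ j, ∑ a, B j a * δ j a ≤ 0) :
    ∃ l : ι → κ, ∑ j, δ j (l j) ≤ 0 ∧ ∑ j, (1 - B j (σ j)) ≤ 2 * #{j | l j ≠ σ j} := by
  classical
  have hne : ∀ j, (univ.erase (σ j)).Nonempty := fun j =>
    (exists_ne (σ j)).imp fun a ha => mem_erase.2 ⟨ha, mem_univ a⟩
  choose a ha hmin using fun j => exists_min_image _ (δ j) (hne j)
  have hB : ∀ j, 1 - B j (σ j) = ∑ x ∈ univ.erase (σ j), B j x := fun j => by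
    rw [← hB1 j, ← add_sum_erase univ (B j) (mem_univ (σ j)), add_sub_cancel_left]
  have hbest : ∑ j, (1 - B j (σ j)) * δ j (a j) ≤ 0 := by
    refine (sum_le_sum fun j _ => ?_).trans hcost
    rw [← add_sum_erase univ _ (mem_univ (σ j)), hδ, mul_zero, zero_add, hB, sum_mul]
    exact sum_le_sum fun x hx => mul_le_mul_of_nonneg_left (hmin j x hx) (hB0 j x)
  obtain ⟨S, hS, hcard⟩ := exists_finset_sum_nonpos
    (fun j => by rw [hB]; exact sum_nonneg fun x _ => hB0 j x)
    (fun j => by linarith [hB0 j (σ j)]) hbest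
  refine ⟨fun j => if j ∈ S then a j else σ j, ?_, ?_⟩
  · rw [← sum_ite_mem_eq S] at hS
    refine le_of_eq_of_le (sum_congr rfl fun j _ => ?_) hS
    by_cases hj : j ∈ S <;> simp only [hj, hδ, if_true, if_false]
  · have hmoved : ({j | (if j ∈ S then a j else σ j) ≠ σ j} : Finset ι) = S := by
      ext j
      by_cases hj : j ∈ S <;> simp [hj, (mem_erase.1 (ha j)).1]
    rwa [hmoved]

end Rounding

section Oracle

variable {n k d : ℕ}

theorem oracle_cost_sub (c : Fin k → EuclideanSpace ℝ (Fin d)) (σ : Fin n → Fin k)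
    (g : Fin n → EuclideanSpace ℝ (Fin d)) (j : Fin n) (a : Fin k) :
    ‖oraclePoint c σ g j - c a‖ ^ 2 - ‖oraclePoint c σ g j - c (σ j)‖ ^ 2
      = ‖c (σ j) - c a‖ ^ 2 + 8 * inner ℝ (g j) (c (σ j) - c a) := by
  have ha : oraclePoint c σ g j - c a = (c (σ j) - c a) + (4 : ℝ) • g j :=
    add_sub_right_comm _ _ _
  have hσ : oraclePoint c σ g j - c (σ j) = (4 : ℝ) • g j := add_sub_cancel_left _ _
  rw [ha, hσ, norm_add_sq_real, inner_smul_right, real_inner_comm]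
  ring

theorem eta_trueAssignment (c : Fin k → EuclideanSpace ℝ (Fin d))
    (h : Fin n → EuclideanSpace ℝ (Fin d)) (l : Fin n → Fin k) :
    eta c h (trueAssignment l) = ∑ j, ‖h j - c (l j)‖ ^ 2 := by
  simp [eta, trueAssignment]

theorem l1_trueAssignment (σ : Fin n → Fin k) : l1 (trueAssignment σ) = n := by
  simp [l1, trueAssignment, apply_ite abs]

theorem l1_trueAssignment_sub (l σ : Fin n → Fin k) :
    l1 (trueAssignment l - trueAssignment σ) = 2 * #{j | l j ≠ σ j} := by
  have hrow : ∀ j, ∑ a, |(trueAssignment l - trueAssignment σ) j a|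
      = if l j ≠ σ j then 2 else 0 := by
    intro j
    split_ifs with hj
    · have habs : ∀ a, |(trueAssignment l - trueAssignment σ) j a|
          = (if l j = a then 1 else 0) + if σ j = a then 1 else 0 := by
        intro a
        simp only [Matrix.sub_apply, trueAssignment, Matrix.of_apply]
        split_ifs with hl hσ <;> first | exact absurd (hl.trans hσ.symm) hj | simp
      simp only [habs, sum_add_distrib, sum_ite_eq, mem_univ, if_true]
      norm_num
    · simp [trueAssignment, not_not.1 hj]
  simp only [l1, hrow, ← sum_filter, sum_const, nsmul_eq_mul, mul_comm]

theorem card_ne_div_le_oracleError {c : Fin k → EuclideanSpace ℝ (Fin d)} {σ l : Fin n → Fin k}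
    {g : Fin n → EuclideanSpace ℝ (Fin d)}
    (hl : ∑ j, (‖c (σ j) - c (l j)‖ ^ 2 + 8 * inner ℝ (g j) (c (σ j) - c (l j))) ≤ 0) :
    2 * #{j | l j ≠ σ j} / n ≤ oracleError c σ g := by
  refine (isGreatest_oracleError c σ g).2 ⟨trueAssignment l, trueAssignment_mem l, ?_, ?_⟩
  · rw [eta_trueAssignment, eta_trueAssignment, ← sub_nonpos, ← sum_sub_distrib]
    simpa only [oracle_cost_sub] using hl
  · rw [l1_trueAssignment_sub, l1_trueAssignment]

theorem fractional_error_le_oracleError (hk : 2 ≤ k) {c : Fin k → EuclideanSpace ℝ (Fin d)}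
    {σ : Fin n → Fin k} {g : Fin n → EuclideanSpace ℝ (Fin d)} {B : Fin n → Fin k → ℝ}
    (hB0 : ∀ j a, 0 ≤ B j a) (hB1 : ∀ j, ∑ a, B j a = 1)
    (hcost : ∑ j, ∑ a, B j a * (‖c (σ j) - c a‖ ^ 2 + 8 * inner ℝ (g j) (c (σ j) - c a)) ≤ 0) :
    (∑ j, (1 - B j (σ j))) / n ≤ oracleError c σ g := by
  have : Nontrivial (Fin k) := Fin.nontrivial_iff_two_le.2 hk
  obtain ⟨l, hl, hcard⟩ := exists_labeling_sum_nonpos (σ := σ)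
    (δ := fun j a => ‖c (σ j) - c a‖ ^ 2 + 8 * inner ℝ (g j) (c (σ j) - c a)) hB0 hB1
    (fun j => by simp) hcost
  exact (by gcongr : _ ≤ _).trans (card_ne_div_le_oracleError hl)

end Oracle

section ClusterMean

variable {ι κ V : Type*} [Fintype ι] [DecidableEq κ]

/-- The average of `f` over the cluster of label `a`, which is `0` for an empty cluster. Composed
with `σ` it is the orthogonal projection onto the functions that are constant on clusters. -/
def clusterMean [AddCommGroup V] [Module ℝ V] (σ : ι → κ) (f : ι → V) (a : κ) : V :=
  (#{l | σ l = a} : ℝ)⁻¹ • ∑ l with σ l = a, f l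

theorem sum_smul_clusterMean [AddCommGroup V] [Module ℝ V] (σ : ι → κ) (y : ι → ℝ) (f : ι → V) :
    ∑ i, y i • clusterMean σ f (σ i) = ∑ i, clusterMean σ y (σ i) • f i := by
  simp only [clusterMean, sum_filter, smul_eq_mul, smul_sum, mul_sum, sum_smul]
  rw [sum_comm]
  refine sum_congr rfl fun i _ => sum_congr rfl fun l _ => ?_
  by_cases h : σ i = σ l
  · simp [h, smul_smul, mul_comm]
  · simp [h, Ne.symm h]

theorem clusterMean_comp_self [AddCommGroup V] [Module ℝ V] (σ : ι → κ) (f : κ → V) (i : ι) :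
    clusterMean σ (fun l => f (σ l)) (σ i) = f (σ i) := by
  have hcard : (#{l | σ l = σ i} : ℝ) ≠ 0 :=
    Nat.cast_ne_zero.2 (card_ne_zero_of_mem (mem_filter.2 ⟨mem_univ i, rfl⟩))
  have hsum : ∑ l with σ l = σ i, f (σ l) = (#{l | σ l = σ i} : ℝ) • f (σ i) := by
    rw [sum_congr rfl fun l hl => congrArg f (mem_filter.1 hl).2, sum_const, Nat.cast_smul_eq_nsmul]
  rw [clusterMean, hsum, inv_smul_smul₀ hcard]

theorem sum_sq_sub_clusterMean (σ : ι → κ) (y : ι → ℝ) :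
    ∑ i, (y i - clusterMean σ y (σ i)) ^ 2
      = ∑ i, y i ^ 2 - ∑ i, y i * clusterMean σ y (σ i) := by
  have hproj : ∑ i, y i * clusterMean σ y (σ i) = ∑ i, clusterMean σ y (σ i) ^ 2 := by
    have h := sum_smul_clusterMean σ y fun i => clusterMean σ y (σ i)
    simpa only [clusterMean_comp_self σ (clusterMean σ y), smul_eq_mul, ← sq] using h
  have hexpand : ∀ i, (y i - clusterMean σ y (σ i)) ^ 2
      = y i ^ 2 - 2 * (y i * clusterMean σ y (σ i)) + clusterMean σ y (σ i) ^ 2 := fun i => by ring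
  simp only [hexpand, sum_add_distrib, sum_sub_distrib, ← mul_sum, ← hproj]
  ring

theorem abs_inner_clusterMean_le [NormedAddCommGroup V] [InnerProductSpace ℝ V] {σ : ι → κ}
    {g : ι → V} {v : V} {q : ℝ} (hq : ∀ i, |inner ℝ (g i) v| ≤ q) (i : ι) :
    |inner ℝ (clusterMean σ g (σ i)) v| ≤ q := by
  have hcard : 0 < (#{l | σ l = σ i} : ℝ) :=
    Nat.cast_pos.2 (card_pos.2 ⟨i, mem_filter.2 ⟨mem_univ i, rfl⟩⟩)
  rw [clusterMean, real_inner_smul_left, sum_inner, abs_mul, abs_of_pos (inv_pos.2 hcard),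
    inv_mul_le_iff₀ hcard, ← nsmul_eq_mul]
  exact (abs_sum_le_sum_abs _ _).trans (sum_le_card_nsmul _ _ _ fun l _ => hq l)

end ClusterMean

theorem two_mul_le_diag_add_diag {ι : Type*} {Y : Matrix ι ι ℝ} (hY : Y.PosSemidef) (i j : ι) :
    2 * Y i j ≤ Y i i + Y j j := by
  have hsymm : Y j i = Y i j := hY.1.apply i j
  have hquad : 0 ≤ Y i i + -Y i j + (Y j j + -Y j i) := by
    simpa [Matrix.mulVec, dotProduct] using
      (hY.submatrix ![i, j]).dotProduct_mulVec_nonneg ![1, -1]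
  linarith

section PosSemidef

variable {ι κ V : Type*} [Fintype ι] {Y : Matrix ι ι ℝ}

theorem exists_eq_sum_mul_of_posSemidef (hY : Y.PosSemidef) :
    ∃ B : Matrix ι ι ℝ, ∀ i j, Y i j = ∑ r, B r i * B r j := by
  classical
  open scoped MatrixOrder in
  obtain ⟨B, rfl⟩ := CStarAlgebra.nonneg_iff_eq_star_mul_self.mp hY.nonneg
  exact ⟨B, fun i j => by simp [Matrix.mul_apply, Matrix.star_apply]⟩

theorem norm_sum_smul_sq [NormedAddCommGroup V] [InnerProductSpace ℝ V] (v : ι → ℝ) (f : ι → V) :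
    ‖∑ i, v i • f i‖ ^ 2 = ∑ i, ∑ j, v i * v j * inner ℝ (f i) (f j) := by
  rw [← real_inner_self_eq_norm_sq, sum_inner]
  refine sum_congr rfl fun i _ => ?_
  rw [inner_sum]
  exact sum_congr rfl fun j _ => by rw [real_inner_smul_left, real_inner_smul_right, mul_assoc]

theorem sum_mul_inner_eq_sum_norm_sq [NormedAddCommGroup V] [InnerProductSpace ℝ V]
    {B : Matrix ι ι ℝ} (hB : ∀ i j, Y i j = ∑ r, B r i * B r j) (f : ι → V) :
    ∑ i, ∑ j, Y i j * inner ℝ (f i) (f j) = ∑ r, ‖∑ i, B r i • f i‖ ^ 2 := by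
  simp only [norm_sum_smul_sq, hB, sum_mul]
  exact (sum_congr rfl fun i _ => sum_comm).trans sum_comm

theorem sum_mul_inner_nonneg [NormedAddCommGroup V] [InnerProductSpace ℝ V]
    (hY : Y.PosSemidef) (f : ι → V) : 0 ≤ ∑ i, ∑ j, Y i j * inner ℝ (f i) (f j) := by
  obtain ⟨B, hB⟩ := exists_eq_sum_mul_of_posSemidef hY
  rw [sum_mul_inner_eq_sum_norm_sq hB]
  positivity

/-- The synthesis operator `v ↦ ∑ i, v i • g i` of a family of vectors. -/
def synthesis [NormedAddCommGroup V] [NormedSpace ℝ V] (g : ι → V) : EuclideanSpace ℝ ι →L[ℝ] V :=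
  ∑ i, (EuclideanSpace.proj i).smulRight (g i)

theorem synthesis_apply [NormedAddCommGroup V] [NormedSpace ℝ V] (g : ι → V)
    (v : EuclideanSpace ℝ ι) : synthesis g v = ∑ i, v i • g i := by
  simp [synthesis]

theorem norm_sum_smul_sq_le [NormedAddCommGroup V] [NormedSpace ℝ V] (g : ι → V) (v : ι → ℝ) :
    ‖∑ i, v i • g i‖ ^ 2 ≤ ‖synthesis g‖ ^ 2 * ∑ i, v i ^ 2 := by
  have h := (synthesis g).le_opNorm (WithLp.toLp 2 v)
  rw [synthesis_apply] at h
  calc ‖∑ i, v i • g i‖ ^ 2 ≤ (‖synthesis g‖ * ‖WithLp.toLp 2 v‖) ^ 2 := by gcongr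
    _ = ‖synthesis g‖ ^ 2 * ∑ i, v i ^ 2 := by rw [mul_pow, EuclideanSpace.real_norm_sq_eq]

theorem sum_mul_inner_sub_clusterMean_le [DecidableEq κ] [NormedAddCommGroup V]
    [InnerProductSpace ℝ V] (hY : Y.PosSemidef) (σ : ι → κ) (g : ι → V) :
    ∑ i, ∑ j, Y i j * inner ℝ (g i - clusterMean σ g (σ i)) (g j - clusterMean σ g (σ j))
      ≤ ‖synthesis g‖ ^ 2 * ∑ i, (Y i i - clusterMean σ (Y i) (σ i)) := by
  obtain ⟨B, hB⟩ := exists_eq_sum_mul_of_posSemidef hY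
  have hmove : ∀ r, ∑ i, B r i • (g i - clusterMean σ g (σ i))
      = ∑ i, (B r i - clusterMean σ (B r) (σ i)) • g i := fun r => by
    simp only [smul_sub, sub_smul, sum_sub_distrib, sum_smul_clusterMean]
  have hmean (i) : ∑ r, B r i * clusterMean σ (B r) (σ i) = clusterMean σ (Y i) (σ i) := by
    simp only [clusterMean, smul_eq_mul, hB, mul_sum]
    rw [sum_comm]
    exact sum_congr rfl fun l _ => sum_congr rfl fun r _ => by ring
  calc ∑ i, ∑ j, Y i j * inner ℝ (g i - clusterMean σ g (σ i)) (g j - clusterMean σ g (σ j))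
      = ∑ r, ‖∑ i, (B r i - clusterMean σ (B r) (σ i)) • g i‖ ^ 2 := by
        simp only [sum_mul_inner_eq_sum_norm_sq hB, hmove]
    _ ≤ ∑ r, ‖synthesis g‖ ^ 2 * ∑ i, (B r i - clusterMean σ (B r) (σ i)) ^ 2 :=
        sum_le_sum fun r _ => norm_sum_smul_sq_le g _
    _ = ‖synthesis g‖ ^ 2 * ∑ r, ∑ i, (B r i ^ 2 - B r i * clusterMean σ (B r) (σ i)) := by
        simp only [← mul_sum, sum_sq_sub_clusterMean, sum_sub_distrib]
    _ = ‖synthesis g‖ ^ 2 * ∑ i, (Y i i - clusterMean σ (Y i) (σ i)) := by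
        rw [sum_comm]
        simp only [sum_sub_distrib, hmean, hB _ _, sq]

end PosSemidef

section Balanced

variable {n k : ℕ} {σ : Fin n → Fin k} {Y : Matrix (Fin n) (Fin n) ℝ}

/-- A labeling all of whose clusters have size exactly `n / k`, as required by `IsBalancedSGMM`. -/
def IsBalanced (σ : Fin n → Fin k) : Prop :=
  ∀ a, (#{i | σ i = a} : ℝ) = n / k

theorem IsBalanced.div_pos (hσ : IsBalanced σ) (i : Fin n) : (0 : ℝ) < n / k := by
  rw [← hσ (σ i)]
  exact Nat.cast_pos.2 (card_pos.2 ⟨i, mem_filter.2 ⟨mem_univ i, rfl⟩⟩)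

theorem IsBalanced.sum_clusterMean_mul (hσ : IsBalanced σ) (y : Fin n → ℝ) (F : Fin k → ℝ) :
    ∑ a, clusterMean σ y a * F a = (n / k : ℝ)⁻¹ * ∑ j, y j * F (σ j) := by
  rw [← sum_fiberwise univ σ, mul_sum]
  refine sum_congr rfl fun a _ => ?_
  rw [clusterMean, hσ, smul_eq_mul, mul_assoc, sum_mul]
  exact congrArg _ (sum_congr rfl fun j hj => by rw [(mem_filter.1 hj).2])

theorem IsBalanced.sum_clusterMatrix (hσ : IsBalanced σ) (i : Fin n) :
    ∑ j, clusterMatrix σ i j = n / k := by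
  rw [← hσ (σ i)]
  simp [clusterMatrix, eq_comm]

theorem posSemidef_clusterMatrix (σ : Fin n → Fin k) : (clusterMatrix σ).PosSemidef := by
  have hfactor : clusterMatrix σ = trueAssignment σ * (trueAssignment σ).conjTranspose := by
    ext i j
    simp [clusterMatrix, trueAssignment, Matrix.mul_apply, eq_comm]
  rw [hfactor]
  exact Matrix.posSemidef_self_mul_conjTranspose _

theorem clusterMatrix_nonneg (σ : Fin n → Fin k) (i j : Fin n) : 0 ≤ clusterMatrix σ i j := by
  simp only [clusterMatrix, Matrix.of_apply]
  split_ifs <;> norm_num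

theorem IsBalanced.clusterMatrix_mem_sdpFeasible (hσ : IsBalanced σ) :
    clusterMatrix σ ∈ sdpFeasible n k :=
  ⟨hσ.sum_clusterMatrix, posSemidef_clusterMatrix σ, fun i => by simp [clusterMatrix],
    clusterMatrix_nonneg σ⟩

theorem IsBalanced.l1_clusterMatrix (hσ : IsBalanced σ) :
    l1 (clusterMatrix σ) = n * (n / k) := by
  simp [l1, abs_of_nonneg (clusterMatrix_nonneg σ _ _), hσ.sum_clusterMatrix]

theorem le_one_of_mem_sdpFeasible (hY : Y ∈ sdpFeasible n k) (i j : Fin n) : Y i j ≤ 1 := by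
  have h := two_mul_le_diag_add_diag hY.2.1 i j
  rw [hY.2.2.1, hY.2.2.1] at h
  linarith

theorem IsBalanced.l1_sub_clusterMatrix (hσ : IsBalanced σ) (hY : Y ∈ sdpFeasible n k) :
    l1 (Y - clusterMatrix σ) = 2 * ∑ i, ∑ j, if σ i = σ j then 0 else Y i j := by
  have habs : ∀ i j, |(Y - clusterMatrix σ) i j|
      = 2 * (if σ i = σ j then 0 else Y i j) - (Y i j - clusterMatrix σ i j) := by
    intro i j
    simp only [Matrix.sub_apply, clusterMatrix, Matrix.of_apply]
    split_ifs
    · rw [abs_of_nonpos] <;> linarith [le_one_of_mem_sdpFeasible hY i j]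
    · rw [abs_of_nonneg] <;> linarith [hY.2.2.2 i j]
  simp only [l1, habs, sum_sub_distrib, ← mul_sum, hY.1, hσ.sum_clusterMatrix, sub_self, sub_zero]

theorem IsBalanced.sum_one_sub_clusterMean (hσ : IsBalanced σ) (hY : Y ∈ sdpFeasible n k) :
    ∑ i, (1 - clusterMean σ (Y i) (σ i)) = l1 (Y - clusterMatrix σ) / (2 * (n / k)) := by
  have hrow : ∀ i, 1 - clusterMean σ (Y i) (σ i)
      = (n / k : ℝ)⁻¹ * ∑ j, if σ i = σ j then 0 else Y i j := by
    intro i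
    have hsplit : (∑ j with σ j = σ i, Y i j) + ∑ j, (if σ i = σ j then 0 else Y i j) = n / k := by
      rw [← hY.1 i, sum_filter, ← sum_add_distrib]
      exact sum_congr rfl fun j _ => by by_cases h : σ i = σ j <;> simp [h, eq_comm]
    rw [clusterMean, hσ, smul_eq_mul, eq_sub_of_add_eq' hsplit, mul_sub,
      inv_mul_cancel₀ (hσ.div_pos i).ne']
  rw [hσ.l1_sub_clusterMatrix hY, sum_congr rfl fun i _ => hrow i, ← mul_sum]
  ring

theorem IsBalanced.mul_l1_sub_clusterMatrix_le (hσ : IsBalanced σ) (hY : Y ∈ sdpFeasible n k)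
    {w : Fin n → Fin n → ℝ} {D : ℝ} (hw : ∀ i j, σ i = σ j → w i j = 0)
    (hD : ∀ i j, σ i ≠ σ j → D ≤ w i j) :
    D * (l1 (Y - clusterMatrix σ) / 2) ≤ ∑ i, ∑ j, Y i j * w i j := by
  rw [hσ.l1_sub_clusterMatrix hY, mul_div_cancel_left₀ _ two_ne_zero]
  simp only [mul_sum]
  refine sum_le_sum fun i _ => sum_le_sum fun j _ => ?_
  split_ifs with h
  · rw [hw i j h, mul_zero, mul_zero]
  · rw [mul_comm]
    exact mul_le_mul_of_nonneg_left (hD i j h) (hY.2.2.2 i j)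

theorem IsBalanced.sum_sub_clusterMatrix_mul_inner_le {V : Type*} [NormedAddCommGroup V]
    [InnerProductSpace ℝ V] (hσ : IsBalanced σ) (hY : Y ∈ sdpFeasible n k) {g : Fin n → V} {q : ℝ}
    (hq : ∀ i j, |inner ℝ (g i) (clusterMean σ g (σ j))| ≤ q) :
    ∑ i, ∑ j, (Y - clusterMatrix σ) i j * inner ℝ (g i) (g j)
      ≤ l1 (Y - clusterMatrix σ) * (3 * q + ‖synthesis g‖ ^ 2 / (2 * (n / k))) := by
  set Z := Y - clusterMatrix σ with hZ
  set e : Fin n → V := fun i => clusterMean σ g (σ i)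
  have hsplit : ∀ i j, inner ℝ (g i) (g j) = inner ℝ (g i - e i) (g j - e j)
      + (inner ℝ (g i) (e j) + inner ℝ (g j) (e i) - inner ℝ (e i) (e j)) := fun i j => by
    simp only [inner_sub_left, inner_sub_right, real_inner_comm (e i) (g j)]
    ring
  have hmean : ∑ i, ∑ j, Z i j * (inner ℝ (g i) (e j) + inner ℝ (g j) (e i) - inner ℝ (e i) (e j))
      ≤ l1 Z * (3 * q) := by
    simp only [l1, sum_mul]
    refine sum_le_sum fun i _ => sum_le_sum fun j _ => (le_abs_self _).trans ?_
    have hee : |inner ℝ (e i) (e j)| ≤ q := abs_inner_clusterMean_le (fun l => hq l j) i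
    rw [abs_mul]
    gcongr
    calc _ ≤ |inner ℝ (g i) (e j)| + |inner ℝ (g j) (e i)| + |inner ℝ (e i) (e j)| :=
          (abs_sub _ _).trans (by gcongr; exact abs_add_le _ _)
      _ ≤ 3 * q := by linarith [hq i j, hq j i]
  have hcentered : ∑ i, ∑ j, Z i j * inner ℝ (g i - e i) (g j - e j)
      ≤ l1 Z * (‖synthesis g‖ ^ 2 / (2 * (n / k))) := by
    have htrace := sum_mul_inner_sub_clusterMean_le hY.2.1 σ g
    simp only [hY.2.2.1, hσ.sum_one_sub_clusterMean hY] at htrace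
    rw [mul_div_left_comm] at htrace
    simp only [hZ, Matrix.sub_apply, sub_mul, sum_sub_distrib]
    exact (sub_le_self _ (sum_mul_inner_nonneg (posSemidef_clusterMatrix σ) _)).trans htrace
  simp only [hsplit, mul_add, sum_add_distrib]
  linarith

end Balanced

section SDP

variable {n k d : ℕ}

theorem frob_eq_sum (M Q : Matrix (Fin n) (Fin n) ℝ) : frob M Q = ∑ i, ∑ j, M i j * Q i j := by
  simp only [frob, Matrix.trace, Matrix.diag, Matrix.mul_apply, Matrix.transpose_apply]
  exact sum_comm

theorem sum_mul_norm_sub_sq {ι V : Type*} [Fintype ι] [NormedAddCommGroup V]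
    [InnerProductSpace ℝ V] {Z : Matrix ι ι ℝ} (hsymm : Z.IsSymm) (hrow : ∀ i, ∑ j, Z i j = 0)
    (x g : ι → V) :
    ∑ i, ∑ j, Z i j * ‖(x i + g i) - (x j + g j)‖ ^ 2
      = ∑ i, ∑ j, Z i j * (‖x i - x j‖ ^ 2 + 4 * inner ℝ (g i) (x i - x j))
        - 2 * ∑ i, ∑ j, Z i j * inner ℝ (g i) (g j) := by
  set f : ι → ι → ℝ := fun i j => 2 * inner ℝ (g i) (x i - x j) + ‖g i‖ ^ 2 with hf
  have hexpand : ∀ i j, ‖(x i + g i) - (x j + g j)‖ ^ 2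
      = ‖x i - x j‖ ^ 2 - 2 * inner ℝ (g i) (g j) + f i j + f j i := fun i j => by
    rw [add_sub_add_comm, norm_add_sq_real, norm_sub_sq_real (g i), real_inner_comm, inner_sub_left]
    simp only [hf, ← neg_sub (x i) (x j), inner_neg_right]
    ring
  have hswap : ∑ i, ∑ j, Z i j * f j i = ∑ i, ∑ j, Z i j * f i j := by
    rw [sum_comm]
    exact sum_congr rfl fun i _ => sum_congr rfl fun j _ => by rw [hsymm.apply]
  have hdiag : ∑ i, ∑ j, Z i j * ‖g i‖ ^ 2 = 0 := by simp [← sum_mul, hrow]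
  simp only [hexpand, mul_add, mul_sub, sum_add_distrib, sum_sub_distrib, hswap]
  simp only [hf, mul_add, sum_add_distrib, hdiag, mul_left_comm _ (2 : ℝ), mul_left_comm _ (4 : ℝ),
    ← mul_sum]
  ring

theorem IsBalanced.sum_mul_le_of_isSDPSolution {σ : Fin n → Fin k} (hσ : IsBalanced σ)
    (c g) {Y : Matrix (Fin n) (Fin n) ℝ}
    (hY : IsSDPSolution k (distMatrix (dataPoint (d := d) c σ g)) Y) :
    ∑ i, ∑ j, Y i j * (‖c (σ i) - c (σ j)‖ ^ 2 + 4 * inner ℝ (g i) (c (σ i) - c (σ j)))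
      ≤ 2 * ∑ i, ∑ j, (Y - clusterMatrix σ) i j * inner ℝ (g i) (g j) := by
  have hsymm : (Y - clusterMatrix σ).IsSymm :=
    hY.1.2.1.isHermitian.sub (posSemidef_clusterMatrix σ).isHermitian
  have hrow : ∀ i, ∑ j, (Y - clusterMatrix σ) i j = 0 := fun i => by
    simp only [Matrix.sub_apply, sum_sub_distrib, hY.1.1, hσ.sum_clusterMatrix, sub_self]
  have hopt : ∑ i, ∑ j, (Y - clusterMatrix σ) i j
      * ‖(c (σ i) + g i) - (c (σ j) + g j)‖ ^ 2 ≤ 0 := by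
    have h := hY.2 _ hσ.clusterMatrix_mem_sdpFeasible
    rw [frob_eq_sum, frob_eq_sum] at h
    simp only [Matrix.sub_apply, sub_mul, sum_sub_distrib]
    exact sub_nonpos.2 h
  rw [sum_mul_norm_sub_sq hsymm hrow (fun i => c (σ i)), sub_nonpos] at hopt
  refine le_of_eq_of_le (sum_congr rfl fun i _ => sum_congr rfl fun j _ => ?_) hopt
  by_cases h : σ i = σ j
  · simp [h]
  · simp [clusterMatrix, h]

theorem IsBalanced.sdp_error_le {σ : Fin n → Fin k} (hσ : IsBalanced σ) (hk : 2 ≤ k)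
    {c : Fin k → EuclideanSpace ℝ (Fin d)} {g : Fin n → EuclideanSpace ℝ (Fin d)} {q D : ℝ}
    (hq : ∀ i j, |inner ℝ (g i) (clusterMean σ g (σ j))| ≤ q)
    (hsep : ∀ a b, a ≠ b → D ≤ ‖c a - c b‖ ^ 2)
    (hD : 24 * q + 4 * ‖synthesis g‖ ^ 2 / (n / k) ≤ D) {Y : Matrix (Fin n) (Fin n) ℝ}
    (hY : IsSDPSolution k (distMatrix (dataPoint c σ g)) Y) :
    l1 (Y - clusterMatrix σ) / l1 (clusterMatrix σ) ≤ 2 * oracleError c σ g := by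
  set γ := l1 (Y - clusterMatrix σ) with hγ
  have hγ0 : 0 ≤ γ := sum_nonneg fun i _ => sum_nonneg fun j _ => abs_nonneg _
  have hcost : ∑ i, ∑ j, Y i j
      * (‖c (σ i) - c (σ j)‖ ^ 2 + 8 * inner ℝ (g i) (c (σ i) - c (σ j))) ≤ 0 := by
    have hopt := hσ.sum_mul_le_of_isSDPSolution c g hY
    have hnoise := hσ.sum_sub_clusterMatrix_mul_inner_le hY.1 hq
    have hgap : D * (γ / 2) ≤ ∑ i, ∑ j, Y i j * ‖c (σ i) - c (σ j)‖ ^ 2 :=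
      hσ.mul_l1_sub_clusterMatrix_le hY.1 (fun i j h => by simp [h]) fun i j => hsep _ _
    have hDγ := mul_le_mul_of_nonneg_left hD hγ0
    simp only [mul_add, mul_left_comm _ (4 : ℝ), mul_left_comm _ (8 : ℝ), sum_add_distrib,
      ← mul_sum] at hopt ⊢
    have hcoeff : γ * (3 * q + ‖synthesis g‖ ^ 2 / (2 * (n / k)))
        = γ * (24 * q + 4 * ‖synthesis g‖ ^ 2 / (n / k)) / 8 := by ring
    linarith
  have hround : (∑ i, (1 - clusterMean σ (Y i) (σ i))) / n ≤ oracleError c σ g := by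
    refine fractional_error_le_oracleError hk (fun i a => ?_) (fun i => ?_) ?_
    · exact mul_nonneg (by positivity) (sum_nonneg fun j _ => hY.1.2.2.2 i j)
    · have hone := hσ.sum_clusterMean_mul (Y i) fun _ => 1
      simpa only [mul_one, hY.1.1, inv_mul_cancel₀ (hσ.div_pos i).ne'] using hone
    · simp only [hσ.sum_clusterMean_mul, ← mul_sum]
      exact mul_nonpos_of_nonneg_of_nonpos (by positivity) hcost
  rw [hσ.sum_one_sub_clusterMean hY.1] at hround
  calc γ / l1 (clusterMatrix σ) = 2 * (γ / (2 * (n / k)) / n) := by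
        rw [hσ.l1_clusterMatrix]; ring
    _ ≤ 2 * oracleError c σ g := by gcongr

end SDP

section PsiTwo

variable {Ω : Type*} [MeasurableSpace Ω] {P : Measure Ω} {X : Ω → ℝ}

theorem exp_le_add_exp_sq (x : ℝ) : Real.exp x ≤ x + Real.exp (x ^ 2) := by
  have h := Real.add_one_le_exp (x ^ 2)
  rcases le_or_gt |x| 1 with hx | hx
  · linarith [(abs_le.1 (Real.abs_exp_sub_one_sub_id_le hx)).2]
  · rcases lt_abs.1 hx with h1 | h1
    · linarith [Real.exp_le_exp.2 (show x ≤ x ^ 2 by nlinarith)]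
    · nlinarith [Real.exp_le_one_iff.2 (show x ≤ 0 by linarith)]

theorem exp_mul_le_of_sq_le_one {l : ℝ} (hl : l ^ 2 ≤ 1) (x : ℝ) :
    Real.exp (l * x) ≤ l * x + (1 - l ^ 2) + l ^ 2 * Real.exp (x ^ 2) := by
  have hconvex : Real.exp (l ^ 2 * x ^ 2) ≤ 1 - l ^ 2 + l ^ 2 * Real.exp (x ^ 2) := by
    simpa using convexOn_exp.2 (Set.mem_univ 0) (Set.mem_univ (x ^ 2))
      (sub_nonneg.2 hl) (sq_nonneg l) (sub_add_cancel 1 (l ^ 2))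
  calc Real.exp (l * x) ≤ l * x + Real.exp (l ^ 2 * x ^ 2) := by
        rw [← mul_pow]; exact exp_le_add_exp_sq _
    _ ≤ _ := by linarith

theorem exp_mul_le_exp_half_sq_mul (l x : ℝ) :
    Real.exp (l * x) ≤ Real.exp (l ^ 2 / 2) * ((1 + Real.exp (x ^ 2)) / 2) := by
  have hhalf : Real.exp (x ^ 2 / 2) ≤ (1 + Real.exp (x ^ 2)) / 2 := by
    have hsq : Real.exp (x ^ 2) = Real.exp (x ^ 2 / 2) ^ 2 := by
      rw [← Real.exp_nat_mul]; congr 1; push_cast; ring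
    nlinarith [sq_nonneg (Real.exp (x ^ 2 / 2) - 1)]
  calc Real.exp (l * x) ≤ Real.exp (l ^ 2 / 2 + x ^ 2 / 2) :=
        Real.exp_le_exp.2 (by nlinarith [sq_nonneg (l - x)])
    _ ≤ _ := by rw [Real.exp_add]; gcongr

theorem integrable_of_integrable_exp_sq (hX : AEMeasurable X P)
    (h : Integrable (fun ω => Real.exp (X ω ^ 2)) P) : Integrable X P := by
  refine h.mono' hX.aestronglyMeasurable (ae_of_all _ fun ω => ?_)
  rw [Real.norm_eq_abs]
  nlinarith [Real.add_one_le_exp (X ω ^ 2), sq_abs (X ω), sq_nonneg (|X ω| - 1)]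

theorem hasSubgaussianMGF_two_of_integral_exp_sq_le_two [IsProbabilityMeasure P]
    (hX : AEMeasurable X P) (hint : Integrable (fun ω => Real.exp (X ω ^ 2)) P)
    (hle : ∫ ω, Real.exp (X ω ^ 2) ∂P ≤ 2) (hmean : ∫ ω, X ω ∂P = 0) :
    HasSubgaussianMGF X 2 P := by
  have hbound (l : ℝ) : Integrable
      (fun ω => Real.exp (l ^ 2 / 2) * ((1 + Real.exp (X ω ^ 2)) / 2)) P :=
    (((integrable_const 1).add hint).div_const 2).const_mul _
  have hexp (l : ℝ) : Integrable (fun ω => Real.exp (l * X ω)) P :=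
    (hbound l).mono' (by fun_prop) (ae_of_all _ fun ω => by
      rw [Real.norm_of_nonneg (Real.exp_pos _).le]
      exact exp_mul_le_exp_half_sq_mul l (X ω))
  refine ⟨hexp, fun l => ?_⟩
  rw [NNReal.coe_ofNat, mul_div_cancel_left₀ _ two_ne_zero, mgf]
  rcases le_or_gt (l ^ 2) 1 with hl | hl
  · have hlin : Integrable (fun ω => l * X ω + (1 - l ^ 2)) P :=
      ((integrable_of_integrable_exp_sq hX hint).const_mul l).add (integrable_const _)
    calc ∫ ω, Real.exp (l * X ω) ∂P
        ≤ ∫ ω, (l * X ω + (1 - l ^ 2) + l ^ 2 * Real.exp (X ω ^ 2)) ∂P :=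
          integral_mono (hexp l) (hlin.add (hint.const_mul _))
            fun ω => exp_mul_le_of_sq_le_one hl (X ω)
      _ = 1 - l ^ 2 + l ^ 2 * ∫ ω, Real.exp (X ω ^ 2) ∂P := by
          rw [integral_add hlin (hint.const_mul _), integral_add
            ((integrable_of_integrable_exp_sq hX hint).const_mul l) (integrable_const _),
            integral_const_mul, integral_const_mul, hmean, integral_const, probReal_univ]
          simp only [mul_zero, smul_eq_mul, one_mul, zero_add]
      _ ≤ Real.exp (l ^ 2) := by nlinarith [Real.add_one_le_exp (l ^ 2), sq_nonneg l]
  · calc ∫ ω, Real.exp (l * X ω) ∂P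
        ≤ ∫ ω, Real.exp (l ^ 2 / 2) * ((1 + Real.exp (X ω ^ 2)) / 2) ∂P :=
          integral_mono (hexp l) (hbound l) fun ω => exp_mul_le_exp_half_sq_mul l (X ω)
      _ = Real.exp (l ^ 2 / 2) * ((1 + ∫ ω, Real.exp (X ω ^ 2) ∂P) / 2) := by
          rw [integral_const_mul, integral_div, integral_add (integrable_const 1) hint,
            integral_const, probReal_univ, smul_eq_mul, one_mul]
      _ ≤ Real.exp (l ^ 2 / 2) * Real.exp (l ^ 2 / 2) := by
          have := Real.add_one_le_exp (l ^ 2 / 2)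
          gcongr
          linarith
      _ = Real.exp (l ^ 2) := by rw [← Real.exp_add, add_halves]

theorem integral_exp_sq_le_two_of_psi2Norm_lt (hX : AEMeasurable X P) {t : ℝ≥0}
    (h : psi2Norm P X < t) :
    Integrable (fun ω => Real.exp ((X ω / t) ^ 2)) P ∧
      ∫ ω, Real.exp ((X ω / t) ^ 2) ∂P ≤ 2 := by
  obtain ⟨s, hs, hs2, hst⟩ : ∃ s : ℝ≥0, 0 < s ∧
      ∫⁻ ω, ENNReal.ofReal (Real.exp (X ω ^ 2 / (s : ℝ) ^ 2)) ∂P ≤ 2 ∧ s < t := by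
    simpa only [psi2Norm, iInf_lt_iff, exists_prop, ENNReal.coe_lt_coe] using h
  have hle : ∫⁻ ω, ENNReal.ofReal (Real.exp ((X ω / t) ^ 2)) ∂P ≤ 2 := by
    refine le_trans (lintegral_mono fun ω => ?_) hs2
    have : (0 : ℝ) < s := hs
    rw [div_pow]
    gcongr
  have hm : AEStronglyMeasurable (fun ω => Real.exp ((X ω / t) ^ 2)) P := by fun_prop
  have hpos : 0 ≤ᵐ[P] fun ω => Real.exp ((X ω / t) ^ 2) :=
    ae_of_all _ fun ω => (Real.exp_pos _).le
  constructor
  · rw [← lintegral_ofReal_ne_top_iff_integrable hm hpos]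
    exact (hle.trans_lt ENNReal.ofNat_lt_top).ne
  · rw [integral_eq_lintegral_of_nonneg_ae hpos hm]
    exact ENNReal.toReal_le_of_le_ofReal zero_le_two (by simpa using hle)

theorem integrable_of_psi2Norm_lt_top (hX : AEMeasurable X P) (h : psi2Norm P X < ∞) :
    Integrable X P := by
  obtain ⟨t, ht⟩ := ENNReal.lt_iff_exists_nnreal_btwn.1 h
  have ht0 : (t : ℝ) ≠ 0 := by
    exact_mod_cast (ENNReal.coe_pos.1 (zero_le.trans_lt ht.1)).ne'
  have := integrable_of_integrable_exp_sq (hX.div_const _)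
    (integral_exp_sq_le_two_of_psi2Norm_lt hX ht.1).1
  simpa only [div_mul_cancel₀ _ ht0] using this.mul_const (t : ℝ)

theorem hasSubgaussianMGF_of_psi2Norm_lt [IsProbabilityMeasure P] (hX : AEMeasurable X P)
    (hmean : ∫ ω, X ω ∂P = 0) {t : ℝ≥0} (h : psi2Norm P X < t) :
    HasSubgaussianMGF X (t ^ 2 * 2) P := by
  have ht0 : (t : ℝ) ≠ 0 := by
    exact_mod_cast (ENNReal.coe_pos.1 (zero_le.trans_lt h)).ne'
  obtain ⟨hint, hle⟩ := integral_exp_sq_le_two_of_psi2Norm_lt hX h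
  have : HasSubgaussianMGF (fun ω => t * (X ω / t)) (t ^ 2 * 2) P :=
    (hasSubgaussianMGF_two_of_integral_exp_sq_le_two (hX.div_const _) hint hle
      (by rw [integral_div, hmean, zero_div])).const_mul t
  simpa only [mul_div_cancel₀ _ ht0] using this

theorem hasSubgaussianMGF_of_psi2Norm_le [IsProbabilityMeasure P] (hX : AEMeasurable X P)
    (hmean : ∫ ω, X ω ∂P = 0) {t : ℝ≥0} (h : psi2Norm P X ≤ t) :
    HasSubgaussianMGF X (t ^ 2 * 2) P := by
  have hlt : ∀ᶠ s in 𝓝[>] t, HasSubgaussianMGF X (s ^ 2 * 2) P := by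
    filter_upwards [self_mem_nhdsWithin] with s hs
    exact hasSubgaussianMGF_of_psi2Norm_lt hX hmean (h.trans_lt (ENNReal.coe_lt_coe.2 hs))
  refine ⟨hlt.exists.choose_spec.integrable_exp_mul, fun l => ?_⟩
  have hcont : Continuous fun s : ℝ≥0 => Real.exp ((s ^ 2 * 2 : ℝ≥0) * l ^ 2 / 2) := by fun_prop
  exact ge_of_tendsto (hcont.continuousWithinAt (s := Set.Ioi t) (x := t))
    (hlt.mono fun s hs => hs.mgf_le l)

end PsiTwo

section Volumetric

variable {Ω E F : Type*} [MeasurableSpace Ω] {P : Measure Ω} [NormedAddCommGroup E]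
  [NormedSpace ℝ E] [FiniteDimensional ℝ E] [NormedAddCommGroup F] [NormedSpace ℝ F]

theorem exists_ball_subset_opNorm_le (T : E →L[ℝ] F) :
    ∃ u, Metric.ball u 1 ⊆ Metric.ball 0 3 ∧ ∀ v ∈ Metric.ball u 1, ‖T‖ ≤ ‖T v‖ := by
  have := FiniteDimensional.proper_real E
  obtain ⟨x, hx, hmax⟩ := (isCompact_closedBall (0 : E) 1).exists_isMaxOn
    ⟨0, Metric.mem_closedBall_self zero_le_one⟩ (f := fun x => ‖T x‖) (by fun_prop)
  have hTx : ‖T‖ ≤ ‖T x‖ := T.opNorm_le_of_unit_norm (norm_nonneg _) fun y hy =>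
    hmax (mem_closedBall_zero_iff.2 hy.le)
  rw [mem_closedBall_zero_iff] at hx
  refine ⟨(2 : ℝ) • x, Metric.ball_subset_ball' ?_, fun v hv => ?_⟩
  · rw [dist_zero_right, norm_smul, Real.norm_ofNat]
    linarith
  · have hnear : ‖T ((2 : ℝ) • x) - T v‖ ≤ ‖T‖ := by
      rw [← map_sub]
      exact T.le_of_opNorm_le_of_le le_rfl (mem_ball_iff_norm'.1 hv).le |>.trans_eq (mul_one _)
    have hfar : ‖T ((2 : ℝ) • x)‖ = 2 * ‖T x‖ := by rw [map_smul, norm_smul, Real.norm_ofNat]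
    linarith [norm_sub_norm_le (T ((2 : ℝ) • x)) (T v)]

/- Averaging over a ball replaces the union bound over a net: if `‖T‖` is large then `‖T v‖` is
large on a whole ball of radius `1` inside the ball of radius `3`. -/
theorem measure_le_opNorm_sq_le [SFinite P] {T : Ω → E →L[ℝ] F}
    (hT : ∀ v, Measurable fun ω => ‖T ω v‖) {r : ℝ} {ε : ℝ≥0∞}
    (h : ∀ v, ‖v‖ < 3 → P {ω | r ≤ ‖T ω v‖ ^ 2} ≤ ε) :
    P {ω | r ≤ ‖T ω‖ ^ 2} ≤ 3 ^ Module.finrank ℝ E * ε := by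
  have := FiniteDimensional.proper_real E
  borelize E
  let μ : Measure E := Measure.addHaar
  set A : Set (Ω × E) := {p | r ≤ ‖T p.1 p.2‖ ^ 2}
  have hA : MeasurableSet A := by
    have hm : Measurable (Function.uncurry fun v ω => ‖T ω v‖) :=
      measurable_uncurry_of_continuous_of_measurable (fun ω => by fun_prop) hT
    exact measurableSet_le measurable_const ((hm.comp measurable_swap).pow_const 2)
  set V : ℝ≥0∞ := μ (Metric.ball 0 1)
  have hV0 : V ≠ 0 := (Metric.measure_ball_pos _ _ zero_lt_one).ne'
  have hV : V ≠ ∞ := measure_ball_lt_top.ne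
  have hslice : ∀ ω ∈ {ω | r ≤ ‖T ω‖ ^ 2},
      V ≤ μ.restrict (Metric.ball 0 3) (Prod.mk ω ⁻¹' A) := fun ω hω => by
    obtain ⟨u, hsub, hu⟩ := exists_ball_subset_opNorm_le (T ω)
    rw [Measure.restrict_apply (hA.preimage measurable_prodMk_left),
      show V = μ (Metric.ball u 1) from (Measure.addHaar_ball_center μ u 1).symm]
    exact measure_mono fun v hv =>
      ⟨le_trans hω (pow_le_pow_left₀ (norm_nonneg _) (hu v hv) 2), hsub hv⟩
  have htotal : ∫⁻ ω, μ.restrict (Metric.ball 0 3) (Prod.mk ω ⁻¹' A) ∂P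
      ≤ 3 ^ Module.finrank ℝ E * ε * V := by
    rw [← Measure.prod_apply hA, Measure.prod_apply_symm hA]
    calc ∫⁻ v in Metric.ball 0 3, P ((fun ω => (ω, v)) ⁻¹' A) ∂μ
        ≤ ∫⁻ _ in Metric.ball 0 3, ε ∂μ :=
          setLIntegral_mono measurable_const fun v hv => h v (mem_ball_zero_iff.1 hv)
      _ = 3 ^ Module.finrank ℝ E * ε * V := by
          have hball := Measure.addHaar_ball_mul_of_pos μ 0 (zero_lt_three (α := ℝ)) 1
          rw [mul_one, ENNReal.ofReal_pow zero_le_three, ENNReal.ofReal_ofNat] at hball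
          rw [setLIntegral_const, hball]
          ring
  calc P {ω | r ≤ ‖T ω‖ ^ 2}
      ≤ P {ω | V ≤ μ.restrict (Metric.ball 0 3) (Prod.mk ω ⁻¹' A)} := measure_mono hslice
    _ ≤ (∫⁻ ω, μ.restrict (Metric.ball 0 3) (Prod.mk ω ⁻¹' A) ∂P) / V :=
        meas_ge_le_lintegral_div (measurable_measure_prodMk_left hA).aemeasurable hV0 hV
    _ ≤ 3 ^ Module.finrank ℝ E * ε := ENNReal.div_le_of_le_mul htotal

end Volumetric

section SubGaussian

variable {Ω : Type*} [MeasurableSpace Ω] {P : Measure Ω}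

theorem three_pow_mul_ofReal_exp_le (p : ℕ) (u : ℝ) :
    (3 : ℝ≥0∞) ^ p * ENNReal.ofReal (2 * Real.exp (-(2 * p + u)))
      ≤ ENNReal.ofReal (2 * Real.exp (-u)) := by
  have hthree : (3 : ℝ) ≤ Real.exp 2 := by linarith [Real.add_one_le_exp (2 : ℝ)]
  have hsplit : Real.exp (-u) = Real.exp 2 ^ p * Real.exp (-(2 * p + u)) := by
    rw [← Real.exp_nat_mul, ← Real.exp_add]; congr 1; ring
  rw [← ENNReal.ofReal_ofNat, ← ENNReal.ofReal_pow zero_le_three,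
    ← ENNReal.ofReal_mul (by positivity), hsplit, mul_left_comm]
  gcongr

theorem hasSubgaussianMGF_mono {X : Ω → ℝ} {c c' : ℝ≥0} (h : HasSubgaussianMGF X c P)
    (hc : c ≤ c') : HasSubgaussianMGF X c' P :=
  ⟨h.integrable_exp_mul, fun t => (h.mgf_le t).trans (Real.exp_le_exp.2 (by gcongr))⟩

theorem measure_le_sq_le_of_hasSubgaussianMGF [IsFiniteMeasure P] {X : Ω → ℝ} {c : ℝ≥0}
    (h : HasSubgaussianMGF X c P) (hc : 0 < c) {u : ℝ} (hu : 0 ≤ u) :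
    P {ω | 2 * c * u ≤ X ω ^ 2} ≤ ENNReal.ofReal (2 * Real.exp (-u)) := by
  have : (0 : ℝ) < c := hc
  have htail (Y : Ω → ℝ) (hY : HasSubgaussianMGF Y c P) :
      P {ω | √(2 * c * u) ≤ Y ω} ≤ ENNReal.ofReal (Real.exp (-u)) := by
    rw [← ofReal_measureReal]
    refine ENNReal.ofReal_le_ofReal ((hY.measure_ge_le (Real.sqrt_nonneg _)).trans_eq ?_)
    rw [Real.sq_sqrt (by positivity), neg_div, mul_div_cancel_left₀ _ (by positivity)]
  calc P {ω | 2 * c * u ≤ X ω ^ 2}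
      ≤ P ({ω | √(2 * c * u) ≤ X ω} ∪ {ω | √(2 * c * u) ≤ (-X) ω}) :=
        measure_mono fun ω hω => by
          have habs := Real.sqrt_le_sqrt hω
          rwa [Real.sqrt_sq_eq_abs, le_abs] at habs
    _ ≤ ENNReal.ofReal (Real.exp (-u)) + ENNReal.ofReal (Real.exp (-u)) :=
        (measure_union_le _ _).trans (add_le_add (htail X h) (htail (-X) h.neg))
    _ = ENNReal.ofReal (2 * Real.exp (-u)) := by
        rw [← two_mul, ENNReal.ofReal_mul zero_le_two, ENNReal.ofReal_ofNat]

end SubGaussian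

section SubGaussianVec

variable {Ω ι E : Type*} [MeasurableSpace Ω] {P : Measure Ω} [NormedAddCommGroup E]
  [InnerProductSpace ℝ E] {X : Ω → E} {g : ι → Ω → E} {c : ℝ≥0}

/-- `X` is a sub-Gaussian random vector with variance proxy `c`, in the sense that all its
one-dimensional marginals `⟪X, u⟫` have a moment generating function at most that of
`N(0, c * ‖u‖²)`. -/
def IsSubGaussianVec (P : Measure Ω) (X : Ω → E) (c : ℝ≥0) : Prop :=
  ∀ u, HasSubgaussianMGF (fun ω => inner ℝ (X ω) u) (‖u‖₊ ^ 2 * c) P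

theorem IsSubGaussianVec.mono {c' : ℝ≥0} (h : IsSubGaussianVec P X c) (hc : c ≤ c') :
    IsSubGaussianVec P X c' :=
  fun u => hasSubgaussianMGF_mono (h u) (by gcongr)

theorem integrable_of_psi2NormVec_lt_top {d : ℕ} {X : Ω → EuclideanSpace ℝ (Fin d)}
    (hX : Measurable X) (h : psi2NormVec P X < ∞) : Integrable X P := by
  refine Integrable.of_eval_piLp fun i => ?_
  have hunit : EuclideanSpace.single i (1 : ℝ) ∈ Metric.sphere 0 1 := by simp
  have hcoord : psi2Norm P (fun ω => inner ℝ (X ω) (EuclideanSpace.single i 1)) < ∞ :=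
    (le_iSup₂ (f := fun u (_ : u ∈ Metric.sphere 0 1) => psi2Norm P fun ω => inner ℝ (X ω) u)
      _ hunit).trans_lt h
  simpa only [EuclideanSpace.inner_single_right, one_mul, conj_trivial]
    using integrable_of_psi2Norm_lt_top (by fun_prop) hcoord

theorem isSubGaussianVec_of_psi2NormVec_le [IsProbabilityMeasure P] {d : ℕ}
    {X : Ω → EuclideanSpace ℝ (Fin d)} (hX : Measurable X) (hmean : ∫ ω, X ω ∂P = 0)
    {t : ℝ≥0} (h : psi2NormVec P X ≤ t) : IsSubGaussianVec P X (t ^ 2 * 2) := by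
  have hint := integrable_of_psi2NormVec_lt_top hX (h.trans_lt ENNReal.coe_lt_top)
  have hmarginal (u) (hu : ‖u‖ = 1) :
      HasSubgaussianMGF (fun ω => inner ℝ (X ω) u) (t ^ 2 * 2) P := by
    refine hasSubgaussianMGF_of_psi2Norm_le (by fun_prop) ?_ ((le_iSup₂
      (f := fun u (_ : u ∈ Metric.sphere 0 1) => psi2Norm P fun ω => inner ℝ (X ω) u)
      u (mem_sphere_zero_iff_norm.2 hu)).trans h)
    simp only [real_inner_comm u, integral_inner hint, hmean, inner_zero_right]
  intro u
  rcases eq_or_ne u 0 with rfl | hu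
  · simp
  · have hscaled : HasSubgaussianMGF (fun ω => ‖u‖ * inner ℝ (X ω) (‖u‖⁻¹ • u))
        (‖u‖₊ ^ 2 * (t ^ 2 * 2)) P :=
      (hmarginal _ (norm_smul_inv_norm hu)).const_mul ‖u‖
    simpa only [inner_smul_right, mul_inv_cancel_left₀ (norm_ne_zero_iff.2 hu)] using hscaled

theorem IsSubGaussianVec.sum_smul [MeasurableSpace E] [OpensMeasurableSpace E]
    (hind : iIndepFun g P) (hg : ∀ i, IsSubGaussianVec P (g i) c) (s : Finset ι) (v : ι → ℝ) :
    IsSubGaussianVec P (fun ω => ∑ i ∈ s, v i • g i ω) ((∑ i ∈ s, ‖v i‖₊ ^ 2) * c) := fun u => by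
  have hindu : iIndepFun (fun i ω => inner ℝ (g i ω) (v i • u)) P :=
    hind.comp (fun i x => inner ℝ x (v i • u)) fun i => by fun_prop
  have hsum := HasSubgaussianMGF.sum_of_iIndepFun hindu (s := s) fun i _ => hg i (v i • u)
  simpa only [sum_inner, real_inner_smul_left, inner_smul_right, nnnorm_smul, mul_pow, mul_sum,
    sum_mul, mul_assoc, mul_left_comm] using hsum

end SubGaussianVec

section Concentration

variable {Ω ι E : Type*} [MeasurableSpace Ω] {P : Measure Ω} [IsProbabilityMeasure P]
  [NormedAddCommGroup E] [InnerProductSpace ℝ E]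
  {X S : Ω → E} {g : ι → Ω → E} {c : ℝ≥0} {u : ℝ}

theorem IsSubGaussianVec.measure_le_inner_sq_le (h : IsSubGaussianVec P X c) (hc : 0 < c)
    {R : ℝ≥0} (hR : 0 < R) {v : E} (hv : ‖v‖ ^ 2 ≤ R) (hu : 0 ≤ u) :
    P {ω | 2 * (R * c) * u ≤ inner ℝ (X ω) v ^ 2} ≤ ENNReal.ofReal (2 * Real.exp (-u)) := by
  have hproxy : ‖v‖₊ ^ 2 * c ≤ R * c := mul_le_mul_left (by exact_mod_cast hv) c
  exact measure_le_sq_le_of_hasSubgaussianMGF (hasSubgaussianMGF_mono (h v) hproxy)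
    (mul_pos hR hc) hu

section FiniteDimensional

variable [FiniteDimensional ℝ E] [MeasurableSpace E] [BorelSpace E]

theorem IsSubGaussianVec.measure_le_norm_sq_le (hX : Measurable X)
    (h : IsSubGaussianVec P X c) (hc : 0 < c) (hu : 0 ≤ u) :
    P {ω | 18 * c * (2 * Module.finrank ℝ E + u) ≤ ‖X ω‖ ^ 2}
      ≤ ENNReal.ofReal (2 * Real.exp (-u)) := by
  have hmarginal (v : E) (hv : ‖v‖ < 3) :
      P {ω | 18 * c * (2 * Module.finrank ℝ E + u) ≤ ‖innerSL ℝ (X ω) v‖ ^ 2}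
        ≤ ENNReal.ofReal (2 * Real.exp (-(2 * Module.finrank ℝ E + u))) := by
    have hproxy : 18 * (c : ℝ) * (2 * Module.finrank ℝ E + u)
        = 2 * ((9 : ℝ≥0) * c) * (2 * Module.finrank ℝ E + u) := by push_cast; ring
    have hsq : ‖v‖ ^ 2 ≤ (9 : ℝ≥0) := by push_cast; nlinarith [norm_nonneg v]
    simpa only [hproxy, innerSL_apply_apply, Real.norm_eq_abs, sq_abs]
      using h.measure_le_inner_sq_le hc (by norm_num) hsq (by positivity)
  have htail := measure_le_opNorm_sq_le (fun v => by simp only [innerSL_apply_apply]; fun_prop)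
    hmarginal
  simpa only [innerSL_apply_norm] using htail.trans (three_pow_mul_ofReal_exp_le _ u)

theorem measure_le_opNorm_synthesis_sq_le [Fintype ι] (hmeas : ∀ i, Measurable (g i))
    (hind : iIndepFun g P) (hg : ∀ i, IsSubGaussianVec P (g i) c) (hc : 0 < c) (hu : 0 ≤ u) :
    P {ω | 162 * c * (2 * Fintype.card ι + 2 * Module.finrank ℝ E + u)
        ≤ ‖synthesis fun i => g i ω‖ ^ 2}
      ≤ ENNReal.ofReal (2 * Real.exp (-u)) := by
  have := FiniteDimensional.proper_real E
  have hmeasv (v : EuclideanSpace ℝ ι) : Measurable fun ω => ∑ i, v i • g i ω := by fun_prop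
  have hvector (v : EuclideanSpace ℝ ι) (hv : ‖v‖ < 3) :
      P {ω | 162 * c * (2 * Fintype.card ι + 2 * Module.finrank ℝ E + u)
          ≤ ‖synthesis (fun i => g i ω) v‖ ^ 2}
        ≤ ENNReal.ofReal (2 * Real.exp (-(2 * Fintype.card ι + u))) := by
    have hproxy : 162 * (c : ℝ) * (2 * Fintype.card ι + 2 * Module.finrank ℝ E + u)
        = 18 * (9 * c : ℝ≥0) * (2 * Module.finrank ℝ E + (2 * Fintype.card ι + u)) := by
      push_cast; ring
    have hsq : ∑ i, ‖v i‖₊ ^ 2 ≤ 9 := by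
      rw [← NNReal.coe_le_coe]
      push_cast
      rw [← EuclideanSpace.norm_sq_eq]
      nlinarith [norm_nonneg v]
    have hsum := (IsSubGaussianVec.sum_smul hind hg univ v).mono (mul_le_mul_left hsq c)
    simpa only [hproxy, synthesis_apply] using
      hsum.measure_le_norm_sq_le (hmeasv v) (by positivity) (by positivity)
  have htail := measure_le_opNorm_sq_le
    (fun v => by simp only [synthesis_apply]; exact (hmeasv v).norm) hvector
  rw [finrank_euclideanSpace] at htail
  exact htail.trans (three_pow_mul_ofReal_exp_le _ u)

end FiniteDimensional

theorem measure_le_of_indepFun {α β : Type*} [MeasurableSpace α] [MeasurableSpace β]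
    {X : Ω → α} {S : Ω → β} (hX : Measurable X) (hS : Measurable S) (hind : IndepFun X S P)
    {A : Set (α × β)} (hA : MeasurableSet A) {ε : ℝ≥0∞}
    (h : ∀ s, P {ω | (X ω, s) ∈ A} ≤ ε) : P {ω | (X ω, S ω) ∈ A} ≤ ε := by
  have := Measure.isProbabilityMeasure_map (μ := P) hS.aemeasurable
  calc P {ω | (X ω, S ω) ∈ A} = (P.map X).prod (P.map S) A := by
        rw [← (indepFun_iff_map_prod_eq_prod_map_map hX.aemeasurable hS.aemeasurable).1 hind,
          Measure.map_apply (hX.prodMk hS) hA]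
        rfl
    _ = ∫⁻ s, P {ω | (X ω, s) ∈ A} ∂(P.map S) := by
        rw [Measure.prod_apply_symm hA]
        exact lintegral_congr fun s =>
          Measure.map_apply hX (hA.preimage measurable_prodMk_right)
    _ ≤ ε := (lintegral_mono h).trans_eq (by rw [lintegral_const, measure_univ, mul_one])

theorem IsSubGaussianVec.measure_le_inner_sq_of_indepFun_le [SecondCountableTopology E]
    [MeasurableSpace E] [BorelSpace E] (hX : Measurable X) (hS : Measurable S)
    (hind : IndepFun X S P) (h : IsSubGaussianVec P X c) (hc : 0 < c) {R : ℝ≥0} (hR : 0 < R)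
    (hu : 0 ≤ u) :
    P {ω | ‖S ω‖ ^ 2 ≤ R ∧ 2 * (R * c) * u ≤ inner ℝ (X ω) (S ω) ^ 2}
      ≤ ENNReal.ofReal (2 * Real.exp (-u)) := by
  have hnorm : MeasurableSet {p : E × E | ‖p.2‖ ^ 2 ≤ R} :=
    measurableSet_le (by fun_prop) (by fun_prop)
  have hinner : MeasurableSet {p : E × E | 2 * (R * c) * u ≤ inner ℝ p.1 p.2 ^ 2} :=
    measurableSet_le (by fun_prop) (by fun_prop)
  refine measure_le_of_indepFun hX hS hind (hnorm.inter hinner) fun s => ?_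
  by_cases hs : ‖s‖ ^ 2 ≤ R
  · exact (measure_mono fun ω hω => hω.2).trans (h.measure_le_inner_sq_le hc hR hs hu)
  · simp [hs]

end Concentration

section CrossTerm

variable {Ω ι E : Type*} [MeasurableSpace Ω] {P : Measure Ω} [IsProbabilityMeasure P]
  [NormedAddCommGroup E] [InnerProductSpace ℝ E] [FiniteDimensional ℝ E] [MeasurableSpace E]
  [BorelSpace E] {g : ι → Ω → E} {c : ℝ≥0} {u : ℝ}

theorem measure_le_inner_sum_sq_le (hmeas : ∀ i, Measurable (g i)) (hind : iIndepFun g P)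
    (hg : ∀ i, IsSubGaussianVec P (g i) c) (hc : 0 < c) {i : ι} {s : Finset ι} (hi : i ∉ s)
    {m : ℝ≥0} (hm : 0 < m) (hs : #s ≤ m) (hu : 0 < u) :
    P {ω | 36 * c ^ 2 * m * (2 * Module.finrank ℝ E + u) * u
        ≤ inner ℝ (g i ω) (∑ l ∈ s, g l ω) ^ 2}
      ≤ ENNReal.ofReal (4 * Real.exp (-u)) := by
  have := FiniteDimensional.proper_real E
  have hSmeas : Measurable fun ω => ∑ l ∈ s, g l ω := by fun_prop
  have hS : IsSubGaussianVec P (fun ω => ∑ l ∈ s, g l ω) (m * c) := by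
    have hsum := IsSubGaussianVec.sum_smul hind hg s 1
    simp only [Pi.one_apply, one_smul, nnnorm_one, one_pow, sum_const, nsmul_eq_mul, mul_one]
      at hsum
    exact hsum.mono (mul_le_mul_left hs c)
  have hindS : IndepFun (g i) (fun ω => ∑ l ∈ s, g l ω) P := by
    simpa only [sum_fn] using (hind.indepFun_finsetSum_of_notMem hmeas hi).symm
  set R : ℝ≥0 := 18 * (m * c) * (2 * Module.finrank ℝ E + u.toNNReal) with hR
  have hRcoe : (R : ℝ) = 18 * (m * c) * (2 * Module.finrank ℝ E + u) := by
    rw [hR]; push_cast; rw [Real.coe_toNNReal u hu.le]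
  have hRpos : 0 < R := by rw [← NNReal.coe_pos, hRcoe]; positivity
  have hlarge : P {ω | R ≤ ‖∑ l ∈ s, g l ω‖ ^ 2} ≤ ENNReal.ofReal (2 * Real.exp (-u)) := by
    simpa only [hRcoe, NNReal.coe_mul] using hS.measure_le_norm_sq_le hSmeas (by positivity) hu.le
  have hsmall := (hg i).measure_le_inner_sq_of_indepFun_le (hmeas i) hSmeas hindS hc hRpos hu.le
  calc _ ≤ P ({ω | R ≤ ‖∑ l ∈ s, g l ω‖ ^ 2} ∪ {ω | ‖∑ l ∈ s, g l ω‖ ^ 2 ≤ R ∧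
          2 * (R * c) * u ≤ inner ℝ (g i ω) (∑ l ∈ s, g l ω) ^ 2}) := by
        refine measure_mono fun ω hω => (le_total (R : ℝ) _).imp id fun h => ⟨h, ?_⟩
        refine le_of_eq_of_le ?_ hω
        rw [hRcoe]; ring
    _ ≤ ENNReal.ofReal (2 * Real.exp (-u)) + ENNReal.ofReal (2 * Real.exp (-u)) :=
        (measure_union_le _ _).trans (add_le_add hlarge hsmall)
    _ = ENNReal.ofReal (4 * Real.exp (-u)) := by
        rw [← ENNReal.ofReal_add (by positivity) (by positivity)]; ring_nf

end CrossTerm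

section ClusterMeanNoise

variable {Ω ι κ E : Type*} [Fintype ι] [DecidableEq κ] [NormedAddCommGroup E]
  [InnerProductSpace ℝ E] {σ : ι → κ}

theorem abs_inner_clusterMean_le_of_erase [DecidableEq ι] (f : ι → E) {i : ι} {a : κ}
    {r t : ℝ} (hi : ‖f i‖ ^ 2 ≤ r)
    (ht : |inner ℝ (f i) (∑ l ∈ ({l | σ l = a} : Finset ι).erase i, f l)| ≤ t) :
    |inner ℝ (f i) (clusterMean σ f a)| ≤ (r + t) / #{l | σ l = a} := by
  rw [clusterMean, inner_smul_right, abs_mul, abs_inv, Nat.abs_cast, ← div_eq_inv_mul]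
  gcongr
  by_cases h : i ∈ ({l | σ l = a} : Finset ι)
  · rw [← add_sum_erase _ _ h, inner_add_right, real_inner_self_eq_norm_sq]
    exact (abs_add_le _ _).trans (add_le_add ((abs_sq _).trans_le hi) ht)
  · rw [erase_eq_of_notMem h] at ht
    exact ht.trans (le_add_of_nonneg_left ((sq_nonneg _).trans hi))

/-- The level that `|⟪g i, clusterMean σ g a⟫|` exceeds with probability at most `6 * exp (-u)`,
for independent noise vectors `g i` in dimension `d` with variance proxy `c` and a cluster of size
`m`. The first term accounts for `‖g i‖²`, the second one for the product of `g i` with the noise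
of the other members of the cluster. -/
def noiseLevel (c m d u : ℝ) : ℝ :=
  (18 * c * (2 * d + u) + √(36 * c ^ 2 * m * (2 * d + u) * u)) / m

variable [MeasurableSpace Ω] {P : Measure Ω} [IsProbabilityMeasure P] [FiniteDimensional ℝ E]
  [MeasurableSpace E] [BorelSpace E] {g : ι → Ω → E} {c : ℝ≥0} {u : ℝ}

theorem measure_noiseLevel_lt_abs_inner_clusterMean_le (hmeas : ∀ i, Measurable (g i))
    (hind : iIndepFun g P) (hg : ∀ i, IsSubGaussianVec P (g i) c) (hc : 0 < c) (i : ι) {a : κ}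
    (ha : (0 : ℝ) < #{l | σ l = a}) (hu : 0 < u) :
    P {ω | noiseLevel c #{l | σ l = a} (Module.finrank ℝ E) u
        < |inner ℝ (g i ω) (clusterMean σ (fun l => g l ω) a)|}
      ≤ ENNReal.ofReal (6 * Real.exp (-u)) := by
  classical
  set s : Finset ι := {l | σ l = a}
  have hcross := measure_le_inner_sum_sq_le (m := #s) hmeas hind hg hc (notMem_erase i s)
    (by exact_mod_cast ha) (by exact_mod_cast card_erase_le) hu
  calc _ ≤ P ({ω | 18 * c * (2 * Module.finrank ℝ E + u) ≤ ‖g i ω‖ ^ 2} ∪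
          {ω | 36 * c ^ 2 * #s * (2 * Module.finrank ℝ E + u) * u
            ≤ inner ℝ (g i ω) (∑ l ∈ s.erase i, g l ω) ^ 2}) := by
        refine measure_mono fun ω hω => ?_
        by_contra hgood
        rw [Set.mem_union, not_or] at hgood
        exact hω.not_ge (abs_inner_clusterMean_le_of_erase (fun l => g l ω) (not_le.1 hgood.1).le
          (Real.abs_le_sqrt (not_le.1 hgood.2).le))
    _ ≤ ENNReal.ofReal (2 * Real.exp (-u)) + ENNReal.ofReal (4 * Real.exp (-u)) :=
        (measure_union_le _ _).trans
          (add_le_add ((hg i).measure_le_norm_sq_le (hmeas i) hc hu.le) hcross)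
    _ = ENNReal.ofReal (6 * Real.exp (-u)) := by
        rw [← ENNReal.ofReal_add (by positivity) (by positivity)]; ring_nf

end ClusterMeanNoise

theorem measure_iUnion_le_ofReal_card_mul {Ω ι : Type*} [MeasurableSpace Ω] {P : Measure Ω}
    [Fintype ι] {B : ι → Set Ω} {ε : ℝ} (h : ∀ i, P (B i) ≤ ENNReal.ofReal ε) :
    P (⋃ i, B i) ≤ ENNReal.ofReal (Fintype.card ι * ε) := by
  calc P (⋃ i, B i) ≤ ∑ i, P (B i) := measure_iUnion_fintype_le P B
    _ ≤ ∑ _i : ι, ENNReal.ofReal ε := sum_le_sum fun i _ => h i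
    _ = ENNReal.ofReal (Fintype.card ι * ε) := by
        rw [sum_const, card_univ, ← ENNReal.ofReal_nsmul, nsmul_eq_mul]

theorem exists_measurableSet_forall_notMem {Ω : Type*} [MeasurableSpace Ω] {P : Measure Ω}
    [IsProbabilityMeasure P] {B : Set Ω} {ε : ℝ} (hε : 0 ≤ ε) (h : P B ≤ ENNReal.ofReal ε) :
    ∃ E, MeasurableSet E ∧ 1 - ε ≤ P.real E ∧ ∀ ω ∈ E, ω ∉ B := by
  have hmeas := measurableSet_toMeasurable P B
  refine ⟨(toMeasurable P B)ᶜ, hmeas.compl, ?_, fun ω hω hB => hω (subset_toMeasurable P B hB)⟩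
  rw [probReal_compl_eq_one_sub hmeas, measureReal_def, measure_toMeasurable]
  exact sub_le_sub_left (ENNReal.toReal_le_of_le_ofReal hε h) 1

theorem minSep_sq_le {k d : ℕ} (c : Fin k → EuclideanSpace ℝ (Fin d)) {a b : Fin k}
    (hab : a ≠ b) : minSep c ^ 2 ≤ ‖c a - c b‖ ^ 2 := by
  have hnonneg : 0 ≤ minSep c := Real.iInf_nonneg fun _ => norm_nonneg _
  have hle : minSep c ≤ ‖c a - c b‖ :=
    ciInf_le (f := fun p : {p : Fin k × Fin k // p.1 ≠ p.2} => ‖c p.1.1 - c p.1.2‖)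
      (Set.finite_range _).bddBelow ⟨(a, b), hab⟩
  gcongr

theorem log_sq_le_four_mul {x : ℝ} (hx : 1 ≤ x) : Real.log x ^ 2 ≤ 4 * x := by
  have hlog : Real.log x ≤ x ^ (2⁻¹ : ℝ) / 2⁻¹ := Real.log_le_rpow_div (by linarith) (by norm_num)
  rw [← one_div (2 : ℝ), ← Real.sqrt_eq_rpow] at hlog
  nlinarith [Real.sq_sqrt (zero_le_one.trans hx), Real.log_nonneg hx, Real.sqrt_nonneg x]

theorem sqrt_noise_le {n k d L v : ℝ} (hn : 0 < n) (hk : 1 ≤ k) (hd : 0 ≤ d) (hL : 0 ≤ L)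
    (hL2 : L ^ 2 ≤ 4 * n) (hv : 0 ≤ v) :
    √(36 * v ^ 2 * (n / k) * (2 * d + 5 * L) * (5 * L)) / (n / k)
      ≤ 6 * v * (4 * √(k * d / n * L) + 10 * k) := by
  have hsq : 36 * v ^ 2 * (n / k) * (2 * d + 5 * L) * (5 * L) / (n / k) ^ 2
      = (6 * v) ^ 2 * (10 * (k * d / n * L) + 25 * (k / n * L ^ 2)) := by
    field_simp
    ring
  have hkL : k / n * L ^ 2 ≤ 4 * k ^ 2 := by
    calc k / n * L ^ 2 ≤ k / n * (4 * n) := by gcongr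
      _ = 4 * k := by field_simp
      _ ≤ 4 * k ^ 2 := by nlinarith
  have hX := Real.sq_sqrt (show 0 ≤ k * d / n * L by positivity)
  rw [← Real.sqrt_sq (show 0 ≤ n / k by positivity), ← Real.sqrt_div' _ (sq_nonneg _),
    Real.sqrt_sq (by positivity), hsq]
  refine Real.sqrt_le_iff.2 ⟨by positivity, ?_⟩
  rw [mul_pow _ (4 * _ + _)]
  gcongr
  nlinarith [Real.sqrt_nonneg (k * d / n * L)]

theorem noiseLevel_add_opNorm_le {n k d v : ℝ} (hn : 1 ≤ n) (hk : 1 ≤ k) (hd : 0 ≤ d)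
    (hv : 0 ≤ v) :
    24 * noiseLevel v (n / k) d (5 * Real.log n)
        + 4 * (162 * v * (2 * n + 2 * d + n)) / (n / k)
      ≤ v * (10000 * (√(k * d / n * Real.log n) + k * d / n + k)) := by
  have hn0 : 0 < n := by linarith
  have hlog : k / n * Real.log n ≤ k := by
    calc k / n * Real.log n ≤ k / n * n := by gcongr; exact Real.log_le_self hn0.le
      _ = k := by field_simp
  have hlinear : 24 * (18 * v * (2 * d + 5 * Real.log n) / (n / k))
        + 4 * (162 * v * (2 * n + 2 * d + n)) / (n / k)
      = v * (2160 * (k / n * Real.log n) + 2160 * (k * d / n) + 1944 * k) := by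
    field_simp
    ring
  have hsqrt := sqrt_noise_le hn0 hk hd (Real.log_nonneg hn) (log_sq_le_four_mul hn) hv
  have hX : 0 ≤ v * √(k * d / n * Real.log n) := by positivity
  have hY : 0 ≤ v * (k * d / n) := by positivity
  have hZ : 0 ≤ v * k := by positivity
  rw [noiseLevel, add_div]
  linarith [mul_le_mul_of_nonneg_left hlog hv]

theorem IsBalanced.surjective {n k : ℕ} {σ : Fin n → Fin k} (hσ : IsBalanced σ) (hn : 0 < n) :
    Function.Surjective σ := fun a => by
  have hcard : (0 : ℝ) < #{i | σ i = a} := by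
    rw [hσ a]
    have := a.pos
    positivity
  obtain ⟨i, hi⟩ := card_pos.1 (Nat.cast_pos.1 hcard)
  exact ⟨i, (mem_filter.1 hi).2⟩

theorem mul_exp_neg_five_mul_log_le_inv {n k : ℝ} (hn : 4 ≤ n) (hk : k ≤ n) :
    n * k * (6 * Real.exp (-(5 * Real.log n))) ≤ n⁻¹ := by
  have hexp : Real.exp (-(5 * Real.log n)) = (n ^ 5)⁻¹ := by
    rw [Real.exp_neg, ← Nat.cast_ofNat (R := ℝ) (n := 5), Real.exp_nat_mul,
      Real.exp_log (by linarith)]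
  calc n * k * (6 * Real.exp (-(5 * Real.log n))) ≤ n * n * (n ^ 2 * (n ^ 5)⁻¹) := by
        rw [hexp]
        gcongr
        nlinarith
    _ = n⁻¹ := by field_simp

theorem IsBalanced.exists_measurableSet_noise_le {Ω E : Type*} [MeasurableSpace Ω] {P : Measure Ω}
    [IsProbabilityMeasure P] [NormedAddCommGroup E] [InnerProductSpace ℝ E]
    [FiniteDimensional ℝ E] [MeasurableSpace E] [BorelSpace E] {n k : ℕ} {σ : Fin n → Fin k}
    {g : Fin n → Ω → E} {c : ℝ≥0} (hσ : IsBalanced σ) (hn : 4 ≤ n) (hmeas : ∀ i, Measurable (g i))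
    (hind : iIndepFun g P) (hg : ∀ i, IsSubGaussianVec P (g i) c) (hc : 0 < c) :
    ∃ G, MeasurableSet G ∧ 1 - (n : ℝ)⁻¹ - 2 * Real.exp (-n) ≤ P.real G ∧ ∀ ω ∈ G,
      (∀ i a, |inner ℝ (g i ω) (clusterMean σ (fun l => g l ω) a)|
        ≤ noiseLevel c (n / k) (Module.finrank ℝ E) (5 * Real.log n)) ∧
      ‖synthesis fun i => g i ω‖ ^ 2 ≤ 162 * c * (2 * n + 2 * Module.finrank ℝ E + n) := by
  have hn' : (4 : ℝ) ≤ n := by exact_mod_cast hn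
  have hkn : (k : ℝ) ≤ n := by
    simpa using Fintype.card_le_of_surjective σ (hσ.surjective (by omega))
  have hlog : 0 < Real.log n := Real.log_pos (by linarith)
  set B : Fin n × Fin k → Set Ω := fun p =>
    {ω | noiseLevel c (n / k) (Module.finrank ℝ E) (5 * Real.log n)
      < |inner ℝ (g p.1 ω) (clusterMean σ (fun l => g l ω) p.2)|} with hB
  have hmean (p) : P (B p) ≤ ENNReal.ofReal (6 * Real.exp (-(5 * Real.log n))) := by
    have hcard : (0 : ℝ) < #{l | σ l = p.2} := by rw [hσ]; exact hσ.div_pos p.1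
    simpa only [hB, hσ p.2] using measure_noiseLevel_lt_abs_inner_clusterMean_le hmeas hind hg hc
      p.1 hcard (by positivity)
  have hmeans : P (⋃ p, B p) ≤ ENNReal.ofReal (n : ℝ)⁻¹ := by
    refine (measure_iUnion_le_ofReal_card_mul hmean).trans (ENNReal.ofReal_le_ofReal ?_)
    simpa only [Fintype.card_prod, Fintype.card_fin, Nat.cast_mul]
      using mul_exp_neg_five_mul_log_le_inv hn' hkn
  have hsynth := measure_le_opNorm_synthesis_sq_le hmeas hind hg hc (Nat.cast_nonneg n)
  rw [Fintype.card_fin] at hsynth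
  obtain ⟨G, hG, hprob, hgood⟩ := exists_measurableSet_forall_notMem
    (P := P) (by positivity) ((measure_union_le _ _).trans ((add_le_add hmeans hsynth).trans_eq
      (ENNReal.ofReal_add (by positivity) (by positivity)).symm))
  refine ⟨G, hG, by linarith, fun ω hω => ?_⟩
  have hnot := hgood ω hω
  rw [Set.mem_union, not_or, Set.mem_iUnion, not_exists] at hnot
  exact ⟨fun i a => not_lt.1 (hnot.1 (i, a)), (not_le.1 hnot.2).le⟩

end HiddenIntegrality

end

theorem theorem1 :
    ∃ Cs C : ℝ, 0 < Cs ∧ 1 ≤ C ∧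
      ∀ {Ω : Type*} [MeasurableSpace Ω] (P : Measure Ω) [IsProbabilityMeasure P]
        (n k d : ℕ) (_ : 4 ≤ n) (_ : 2 ≤ k) (τ : ℝ) (_ : 0 < τ)
        (c : Fin k → EuclideanSpace ℝ (Fin d)) (σ : Fin n → Fin k)
        (g : Fin n → Ω → EuclideanSpace ℝ (Fin d))
        (_ : HiddenIntegrality.IsBalancedSGMM P τ σ g)
        (_ : Cs * (Real.sqrt ((k : ℝ) * d / n * Real.log n) + (k : ℝ) * d / n + k)
          ≤ (HiddenIntegrality.minSep c / τ) ^ 2),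
        ∃ E : Set Ω, MeasurableSet E ∧
          1 - (n : ℝ) ^ (-C) - 2 * Real.exp (-(n : ℝ)) ≤ P.real E ∧
          ∀ ω ∈ E, ∀ Yhat : Matrix (Fin n) (Fin n) ℝ,
            HiddenIntegrality.IsSDPSolution k
              (HiddenIntegrality.distMatrix
                (HiddenIntegrality.dataPoint c σ fun i => g i ω)) Yhat →
            HiddenIntegrality.l1 (Yhat - HiddenIntegrality.clusterMatrix σ) /
                HiddenIntegrality.l1 (HiddenIntegrality.clusterMatrix σ)
              ≤ 2 * HiddenIntegrality.oracleError c σ fun i => g i ω := by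
  open HiddenIntegrality in
  refine ⟨20000, 1, by norm_num, le_rfl, fun P _ n k d hn hk τ hτ c σ g hmodel hsep => ?_⟩
  have hσ : IsBalanced σ := hmodel.balanced
  have hg (i) : IsSubGaussianVec P (g i) (τ.toNNReal ^ 2 * 2) :=
    isSubGaussianVec_of_psi2NormVec_le (hmodel.measurable i) (hmodel.mean_zero i)
      (hmodel.subGaussian i)
  obtain ⟨E, hE, hprob, hnoise⟩ := hσ.exists_measurableSet_noise_le hn hmodel.measurable
    hmodel.indep hg (by positivity)
  refine ⟨E, hE, by rwa [Real.rpow_neg_one], fun ω hω Y hY => ?_⟩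
  obtain ⟨hmean, hsynth⟩ := hnoise ω hω
  refine hσ.sdp_error_le hk (fun i j => hmean i (σ j)) (fun a b => minSep_sq_le c) ?_ hY
  rw [finrank_euclideanSpace_fin] at hsynth ⊢
  rw [div_pow, le_div_iff₀ (by positivity)] at hsep
  have hnoise_le := noiseLevel_add_opNorm_le (n := n) (k := k) (d := d) (by norm_cast; omega)
    (by norm_cast; omega) (Nat.cast_nonneg d) (τ.toNNReal ^ 2 * 2).coe_nonneg
  refine le_trans (by gcongr) (hnoise_le.trans ?_)
  push_cast
  rw [Real.coe_toNNReal τ hτ.le]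
  linarith
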